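/- Consider one thermal generator over periods $1,\dots,T$ that has been on for $s_0\ge 1$ periods before period $1$. Its data are: the min-up time $L$, the max-up time $\overline L$ and the min-down time $\ell$ (integers with $1\le L\le\overline L$, $\ell\ge1$, $s_0\le\overline L$, $L\le s_0+T$); flags $\kappa_t,\varpi_{kt}\in\{0,1\}$ that say whether the min-up time is enforced after a start-up at $t$ and whether the min-down time is enforced for the OFF interval between last ON period $k$ and next start-up $t$ (this includes flags depending on $k$ only or on $t$ only); real, time-dependent capacity bounds $\underline P_s,\overline P_s$, ramp limits $V^u_s,V^e_s$ and start-up/shut-down ramp limits $\overline V^u_s,\overline V^e_s$; slopes and intercepts $a_j,b_j$, $1\le j\le N$, $N\ge1$, of a convex piecewise-linear generation cost; and real shut-down costs $S(\cdot)$ and start-up costs $S'(\cdot)$ depending on the preceding on-time and off-time. Put $t_0=\max\{L-s_0,0\}$; $L_t=L$ if $\kappa_t=1$ and $L_t=1$ otherwise; $\ell_{kt}=\ell$ if $\varpi_{kt}=1$ and $\ell_{kt}=1$ otherwise. Index sets: $\mathcal K=[t_0,\min\{\overline L-s_0,T\}]_{\mathbb Z}$; $\mathcal{KT}=\{(k,t):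 t_0\le k,\ k+\ell_{kt}+1\le t\le T\}$ (OFF intervals); $\mathcal{TK}^1=\{(1,k):k\in\mathcal K,\ k\ge1\}$ (first ON intervals); $\mathcal R=\{t:(k,t)\in\mathcal{KT}\text{ for some }k\}$ (start-up times); $\mathcal{TK}^2=\{(t,k): t\in\mathcal R,\ \min\{t+L_t-1,T\}\le k\le\min\{t+\overline L-1,T\}\}$ (later ON intervals); $\mathcal{TK}=\mathcal{TK}^1\cup\mathcal{TK}^2$. Let $\mathcal D^4$ be the set of all real $(w,y,z,\theta,q,\phi)$, with $w$ indexed by $\mathcal K$, $y$ by $\mathcal{TK}^2$, $z$ by $\mathcal{KT}$, $\theta$ by $[t_0,T-1]_{\mathbb Z}$, and $q^s_{tk},\phi^s_{tk}$ by $(t,k)\in\mathcal{TK}$, $s\in[t,k]_{\mathbb Z}$, such that $w,y,z,\theta\ge0$ and \begin{align*} &\textstyle\sum_{k\in\mathcal K}w_k=1,\\ &\textstyle -w_{t'}1_{\{t'\in\mathcal K\}}+\sum_{(t',k)\in\mathcal{KT}}z_{t'k}-\sum_{(k,t')\in\mathcal{TK}^2}y_{kt'}+\theta_{t'}=0,&&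 t'\in[t_0,T-1]_{\mathbb Z},\\ &\textstyle\sum_{(t',k)\in\mathcal{TK}^2}y_{t'k}-\sum_{(k,t')\in\mathcal{KT}}z_{kt'}=0,&& t'\in\mathcal R, \end{align*} and, for every $(t,k)\in\mathcal{TK}$, with $r_{tk}=w_k$ on $\mathcal{TK}^1$ and $r_{tk}=y_{tk}$ on $\mathcal{TK}^2$: $\underline P_sr_{tk}\le q^s_{tk}\le\overline P_sr_{tk}$ and $\phi^s_{tk}-a_jq^s_{tk}\ge b_jr_{tk}$ for all $s\in[t,k]_{\mathbb Z}$ and all $j$; $q^{s-1}_{tk}-q^s_{tk}\le V^e_sr_{tk}$ and $q^s_{tk}-q^{s-1}_{tk}\le V^u_sr_{tk}$ for $s\in[t+1,k]_{\mathbb Z}$; $q^k_{tk}\le\overline V^e_kr_{tk}$ if $k\le T-1$; and $q^t_{tk}\le\overline V^u_ty_{tk}$ if $(t,k)\in\mathcal{TK}^2$. Let $\mathcal U$ be the set of the points $(w,y,z,\theta,q,\phi)$ that describe a feasible schedule $(u,x,f)$ (on/off status, generation amount, generation cost) of the generator. A schedule is feasible if: the generator is initially on; with the $s_0$ earlier periods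 counted, its initial ON interval has length at most $\overline L$ and, unless it lasts through $T$, at least $L$; every later maximal ON interval, starting at $t$, has length at most $\overline L$ and, unless it lasts through $T$, at least $L_t$; every OFF interval between last ON period $k$ and start-up $t$ has length at least $\ell_{kt}$; $x_s=f_s=0$ in OFF periods; $\underline P_s\le x_s\le\overline P_s$ and $f_s\ge a_jx_s+b_j$ for all $j$ in ON periods; $x_s\le\overline V^u_s$ at a start-up at $s$; $x_s\le\overline V^e_s$ in an ON period $1\le s\le T-1$ followed by an OFF period; and $x_{s-1}-x_s\le V^e_s$, $x_s-x_{s-1}\le V^u_s$ for consecutive ON periods $s-1,s\in[1,T]$. The point describes the schedule if $w_k,y_{tk},z_{kt},\theta_k$ are the indicators of: the initial ON interval ends at $k$; $[t,k]$ is a later maximal ON interval; $k$ is ON, $k+1,\dots,t-1$ are OFF and $t$ is ON; $k<T$ is ON and all later periods are OFF; and if $q^s_{tk}=x_s$, $\phi^s_{tk}=f_s$ on the ON intervals used and $q^s_{tk}=0$, $\phi^s_{tk}\ge0$ on the others. Theorem. (i) $\mathcal D^4=\operatorname{conv}(\mathcal U)$, and $\mathcal U$ is exactly the set of points of $\mathcal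 D^4$ whose $w$, $y$ and $z$ are binary. (ii) If $\mathcal D^4\ne\emptyset$, every linear objective that is bounded below on $\mathcal D^4$ attains its minimum over $\mathcal D^4$ at a point with binary $w,y,z$. (iii) If $\mathcal D^4\ne\emptyset$, the linear program of minimizing $$\sum_{k\in\mathcal K,\,k<T}S(k+s_0)w_k+\sum_{(t,k)\in\mathcal{TK}^2,\,k<T}S(k-t+1)y_{tk}+\sum_{(k,t)\in\mathcal{KT}}S'(t-k-1)z_{kt}+\sum_{(t,k)\in\mathcal{TK}}\sum_{s=t}^k\phi^s_{tk}$$ over $\mathcal D^4$ has an optimal solution with binary $w$, $y$, $z$. -/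

import Mathlib

/-- Data of a single thermal generator over the operating periods `1, …, T`. -/
structure Generator where
  /-- number of operating periods -/
  T : ℕ
  /-- number of periods the generator has been on just before period `1` -/
  s0 : ℕ
  /-- minimum-up time -/
  L : ℕ
  /-- maximum-up time -/
  Lmax : ℕ
  /-- minimum-down time -/
  ell : ℕ
  /-- `kappa t`: the minimum-up time is enforced for a start-up at period `t` -/
  kappa : ℕ → Bool
  /-- `varpi k t`: the minimum-down time is enforced for the off-interval whose last on-period
  before it is `k` and whose next start-up is at `t` -/
  varpi : ℕ → ℕ → Bool
  /-- minimum generation amount at each period -/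
  Pmin : ℕ → ℝ
  /-- maximum generation amount at each period -/
  Pmax : ℕ → ℝ
  /-- ramp-up limit at each period -/
  Vu : ℕ → ℝ
  /-- ramp-down limit at each period -/
  Ve : ℕ → ℝ
  /-- start-up ramp limit at each period -/
  VuStart : ℕ → ℝ
  /-- shut-down ramp limit at each period -/
  VeShut : ℕ → ℝ
  /-- number of pieces of the generation cost -/
  N : ℕ
  /-- slopes of the pieces of the generation cost -/
  a : Fin N → ℝ
  /-- intercepts of the pieces of the generation cost -/
  b : Fin N → ℝ
  /-- shut-down cost as a function of the preceding on-time -/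
  S : ℕ → ℝ
  /-- start-up cost as a function of the preceding off-time -/
  S' : ℕ → ℝ

namespace Generator

/-- The parameter conventions: positive time limits, min-up at most max-up, the initial on-time is
positive and does not exceed max-up, the initial min-up requirement ends within the horizon, and
the cost has at least one piece. -/
structure Valid (g : Generator) : Prop where
  one_le_L : 1 ≤ g.L
  one_le_ell : 1 ≤ g.ell
  L_le_Lmax : g.L ≤ g.Lmax
  one_le_s0 : 1 ≤ g.s0
  s0_le_Lmax : g.s0 ≤ g.Lmax
  L_le : g.L ≤ g.s0 + g.T
  N_pos : 1 ≤ g.N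

/-- `[L - s0]⁺` (truncated subtraction): no shut-down can happen before period `t0 + 1`. -/
def t0 (g : Generator) : ℕ := g.L - g.s0

/-- Effective min-up time after a start-up at `t`. -/
def minUp (g : Generator) (t : ℕ) : ℕ := if g.kappa t then g.L else 1

/-- Effective min-down time of the off-interval with last on-period `k` and start-up at `t`. -/
def minDown (g : Generator) (k t : ℕ) : ℕ := if g.varpi k t then g.ell else 1

/-! ### Index sets -/

/-- Possible last periods of the initial on-interval. -/
def Kbar (g : Generator) : Finset ℕ := Finset.Icc g.t0 (min (g.Lmax - g.s0) g.T)

/-- Off-intervals `(k, t)`: on at `k`, off at `k+1, …, t-1`, started up at `t`. -/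
def KT (g : Generator) : Finset (ℕ × ℕ) :=
  (Finset.Icc g.t0 g.T ×ˢ Finset.Icc g.t0 g.T).filter fun i => i.1 + g.minDown i.1 i.2 + 1 ≤ i.2

/-- Possible start-up periods. -/
def Starts (g : Generator) : Finset ℕ := g.KT.image Prod.snd

/-- Nonempty first on-intervals `[1, k]`. -/
def TK1 (g : Generator) : Finset (ℕ × ℕ) :=
  {1} ×ˢ Finset.Icc (max 1 g.t0) (min (g.Lmax - g.s0) g.T)

/-- Later on-intervals `[t, k]`, which begin with a start-up at `t`. -/
def TK2 (g : Generator) : Finset (ℕ × ℕ) :=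
  (g.Starts ×ˢ Finset.Icc 1 g.T).filter fun i =>
    min (i.1 + g.minUp i.1 - 1) g.T ≤ i.2 ∧ i.2 ≤ min (i.1 + g.Lmax - 1) g.T

/-- All on-intervals. -/
def TK (g : Generator) : Finset (ℕ × ℕ) := g.TK1 ∪ g.TK2

/-- Periods `t` for which there is a variable `θ t`. -/
def ThetaIdx (g : Generator) : Finset ℕ := Finset.Ico g.t0 g.T

/-- Triples `(t, k, s)` with `[t, k]` an on-interval and `t ≤ s ≤ k`. -/
def QIdx (g : Generator) : Finset (ℕ × ℕ × ℕ) :=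
  g.TK.biUnion fun i => (Finset.Icc i.1 i.2).image fun s => (i.1, i.2, s)

/-- The space of the variables `(w, y, z, θ, q, φ)`. -/
abbrev Space (g : Generator) : Type :=
  (g.Kbar → ℝ) × (g.TK2 → ℝ) × (g.KT → ℝ) × (g.ThetaIdx → ℝ) × (g.QIdx → ℝ) × (g.QIdx → ℝ)

/-- The value of a family at an index, read as `0` outside its index set. -/
def val {α : Type} [DecidableEq α] {A : Finset α} (f : A → ℝ) (i : α) : ℝ :=
  if h : i ∈ A then f ⟨i, h⟩ else 0

/-- `w k`: the first shut-down is at `k + 1` (`k = T`: there is none). -/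
def w (g : Generator) (p : g.Space) (k : ℕ) : ℝ := val p.1 k

/-- `y t k`: `[t, k]` is an on-interval that begins with a start-up. -/
def y (g : Generator) (p : g.Space) (t k : ℕ) : ℝ := val p.2.1 (t, k)

/-- `z k t`: there is a shut-down at `k + 1` and the next start-up is at `t`. -/
def z (g : Generator) (p : g.Space) (k t : ℕ) : ℝ := val p.2.2.1 (k, t)

/-- `θ k`: there is a shut-down at `k + 1` and no later start-up. -/
def theta (g : Generator) (p : g.Space) (k : ℕ) : ℝ := val p.2.2.2.1 k

/-- Generation amount at `s` in the on-interval `[t, k]`. -/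
def q (g : Generator) (p : g.Space) (t k s : ℕ) : ℝ := val p.2.2.2.2.1 (t, k, s)

/-- Generation cost at `s` in the on-interval `[t, k]`. -/
def phi (g : Generator) (p : g.Space) (t k s : ℕ) : ℝ := val p.2.2.2.2.2 (t, k, s)

/-! ### The linear program -/

/-- The dispatch constraints of an on-interval `[t, k]`, scaled by the variable `r` of that
interval; the start-up limit is not part of them. -/
structure Dispatch (g : Generator) (p : g.Space) (t k : ℕ) (r : ℝ) : Prop where
  cap_lower : ∀ s ∈ Finset.Icc t k, g.Pmin s * r ≤ g.q p t k s
  cap_upper : ∀ s ∈ Finset.Icc t k, g.q p t k s ≤ g.Pmax s * r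
  shut : k + 1 ≤ g.T → g.q p t k k ≤ g.VeShut k * r
  ramp_down : ∀ s ∈ Finset.Icc (t + 1) k, g.q p t k (s - 1) - g.q p t k s ≤ g.Ve s * r
  ramp_up : ∀ s ∈ Finset.Icc (t + 1) k, g.q p t k s - g.q p t k (s - 1) ≤ g.Vu s * r
  cost : ∀ s ∈ Finset.Icc t k, ∀ j, g.b j * r ≤ g.phi p t k s - g.a j * g.q p t k s

/-- All constraints of the extended interval-based formulation. -/
structure Feasible (g : Generator) (p : g.Space) : Prop where
  first : ∑ k ∈ g.Kbar, g.w p k = 1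
  balance_down : ∀ t' ∈ g.ThetaIdx,
    -g.w p t' + ∑ i ∈ g.KT with i.1 = t', g.z p i.1 i.2
      - ∑ i ∈ g.TK2 with i.2 = t', g.y p i.1 i.2 + g.theta p t' = 0
  balance_up : ∀ t' ∈ g.Starts,
    ∑ i ∈ g.TK2 with i.1 = t', g.y p i.1 i.2 - ∑ i ∈ g.KT with i.2 = t', g.z p i.1 i.2 = 0
  dispatch_first : ∀ i ∈ g.TK1, g.Dispatch p i.1 i.2 (g.w p i.2)
  dispatch_later : ∀ i ∈ g.TK2, g.Dispatch p i.1 i.2 (g.y p i.1 i.2)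
  start : ∀ i ∈ g.TK2, g.q p i.1 i.2 i.1 ≤ g.VuStart i.1 * g.y p i.1 i.2
  w_nonneg : ∀ k ∈ g.Kbar, 0 ≤ g.w p k
  y_nonneg : ∀ i ∈ g.TK2, 0 ≤ g.y p i.1 i.2
  z_nonneg : ∀ i ∈ g.KT, 0 ≤ g.z p i.1 i.2
  theta_nonneg : ∀ k ∈ g.ThetaIdx, 0 ≤ g.theta p k

/-- The polyhedron cut out by the constraints. -/
def D4 (g : Generator) : Set g.Space := {p | g.Feasible p}

/-- The objective: shut-down, start-up and generation costs. (All subtractions are of a smaller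
number from a larger one on the index sets.) -/
def cost (g : Generator) (p : g.Space) : ℝ :=
  ∑ k ∈ g.Kbar with k < g.T, g.S (k + g.s0) * g.w p k
    + ∑ i ∈ g.TK2 with i.2 < g.T, g.S (i.2 - i.1 + 1) * g.y p i.1 i.2
    + ∑ i ∈ g.KT, g.S' (i.2 - i.1 - 1) * g.z p i.1 i.2
    + ∑ i ∈ g.TK, ∑ s ∈ Finset.Icc i.1 i.2, g.phi p i.1 i.2 s

/-- `w`, `y` and `z` take only the values `0` and `1`. -/
def IsBinary (g : Generator) (p : g.Space) : Prop :=
  (∀ k ∈ g.Kbar, g.w p k = 0 ∨ g.w p k = 1) ∧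
  (∀ i ∈ g.TK2, g.y p i.1 i.2 = 0 ∨ g.y p i.1 i.2 = 1) ∧
  (∀ i ∈ g.KT, g.z p i.1 i.2 = 0 ∨ g.z p i.1 i.2 = 1)

/-! ### The unit commitment problem

A schedule consists of the on/off status `u s`, the generation amount `x s` and the generation
cost `f s` at the periods `s`. Only the periods `0, …, T` matter; `u 0` is the initial status. -/

/-- The generator stays on from the beginning through `k` and no longer (within the horizon). -/
def InitialRun (g : Generator) (u : ℕ → Prop) (k : ℕ) : Prop :=
  k ≤ g.T ∧ (∀ s, s ≤ k → u s) ∧ (k < g.T → ¬ u (k + 1))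

/-- `[t, k]` is a maximal interval of on-periods that begins with a start-up at `t`. -/
def OnRun (g : Generator) (u : ℕ → Prop) (t k : ℕ) : Prop :=
  1 ≤ t ∧ t ≤ k ∧ k ≤ g.T ∧ ¬ u (t - 1) ∧ (∀ s, t ≤ s → s ≤ k → u s) ∧ (k < g.T → ¬ u (k + 1))

/-- The generator is on at `k`, off at `k+1, …, t-1` (at least one period), and on at `t`. -/
def OffRun (g : Generator) (u : ℕ → Prop) (k t : ℕ) : Prop :=
  k + 1 < t ∧ t ≤ g.T ∧ u k ∧ (∀ s, k < s → s < t → ¬ u s) ∧ u t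

/-- The generator is on at `k < T` and off from `k+1` to the end of the horizon. -/
def FinalOff (g : Generator) (u : ℕ → Prop) (k : ℕ) : Prop :=
  k < g.T ∧ u k ∧ ∀ s, k < s → s ≤ g.T → ¬ u s

/-- The on/off schedule respects the initial condition and the min-up, max-up and min-down
times. -/
structure Commitment (g : Generator) (u : ℕ → Prop) : Prop where
  initially_on : u 0
  first_up : ∀ k, g.InitialRun u k → (k < g.T → g.L ≤ g.s0 + k) ∧ g.s0 + k ≤ g.Lmax
  later_up : ∀ t k, g.OnRun u t k →
    (k < g.T → g.minUp t ≤ k - t + 1) ∧ k - t + 1 ≤ g.Lmax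
  down : ∀ k t, g.OffRun u k t → g.minDown k t ≤ t - k - 1

/-- The generation amounts and costs respect the capacity, ramping and cost restrictions. -/
structure Operation (g : Generator) (u : ℕ → Prop) (x f : ℕ → ℝ) : Prop where
  off : ∀ s ∈ Finset.Icc 1 g.T, ¬ u s → x s = 0 ∧ f s = 0
  cap : ∀ s ∈ Finset.Icc 1 g.T, u s → g.Pmin s ≤ x s ∧ x s ≤ g.Pmax s
  start : ∀ s ∈ Finset.Icc 1 g.T, ¬ u (s - 1) → u s → x s ≤ g.VuStart s
  shut : ∀ s ∈ Finset.Ico 1 g.T, u s → ¬ u (s + 1) → x s ≤ g.VeShut s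
  ramp : ∀ s ∈ Finset.Icc 2 g.T, u (s - 1) → u s →
    x (s - 1) - x s ≤ g.Ve s ∧ x s - x (s - 1) ≤ g.Vu s
  cost : ∀ s ∈ Finset.Icc 1 g.T, u s → ∀ j, g.a j * x s + g.b j ≤ f s

/-- `r` is the indicator of `P`. -/
def IsIndicator (P : Prop) (r : ℝ) : Prop := (P → r = 1) ∧ (¬ P → r = 0)

/-- On the interval `[t, k]`, the point carries the amounts and costs of the schedule if the
interval is used (`P`), and no generation and a nonnegative cost if it is not. -/
def Carries (g : Generator) (p : g.Space) (x f : ℕ → ℝ) (t k : ℕ) (P : Prop) : Prop :=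
  ∀ s ∈ Finset.Icc t k,
    (P → g.q p t k s = x s ∧ g.phi p t k s = f s) ∧ (¬ P → g.q p t k s = 0 ∧ 0 ≤ g.phi p t k s)

/-- The point `p` is the description of the schedule `(u, x, f)` by on- and off-intervals. -/
structure Encodes (g : Generator) (p : g.Space) (u : ℕ → Prop) (x f : ℕ → ℝ) : Prop where
  w_eq : ∀ k ∈ g.Kbar, IsIndicator (g.InitialRun u k) (g.w p k)
  y_eq : ∀ i ∈ g.TK2, IsIndicator (g.OnRun u i.1 i.2) (g.y p i.1 i.2)
  z_eq : ∀ i ∈ g.KT, IsIndicator (g.OffRun u i.1 i.2) (g.z p i.1 i.2)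
  theta_eq : ∀ k ∈ g.ThetaIdx, IsIndicator (g.FinalOff u k) (g.theta p k)
  first : ∀ i ∈ g.TK1, g.Carries p x f i.1 i.2 (g.InitialRun u i.2)
  later : ∀ i ∈ g.TK2, g.Carries p x f i.1 i.2 (g.OnRun u i.1 i.2)

/-- The feasible set of the single-generator unit commitment problem, in the variables
`(w, y, z, θ, q, φ)`: the points that describe a feasible schedule. -/
def UC (g : Generator) : Set g.Space :=
  {p | ∃ (u : ℕ → Prop) (x f : ℕ → ℝ), g.Commitment u ∧ g.Operation u x f ∧ g.Encodes p u x f}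

end Generator

/-! The constraints on `w`, `y`, `z`, `θ` describe a unit flow in an acyclic network. Its inner
nodes are the shut-downs after a period `k < T` and the start-ups at `t`; `w` leads from the source
to a shut-down, `z` from a shut-down to the next start-up, `y` from a start-up to the next
shut-down, `θ` from a shut-down to the sink, and on-intervals ending at `T` also run into the sink.
Let each edge occupy the periods of its interval. By conservation, the edges that occupy any fixed
period carry total flow one (`IsFlow.cut_eq_one`). So no edge carries more than one, and the edges
used by a binary flow tile the periods `0, …, T`: such a flow is an on/off schedule.

The dispatch constraints of an interval are the constraints of a schedule made homogeneous by the
flow `r` of that interval. At `r = 1` they are the original constraints; at `r = 0` the capacity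
bounds force zero generation, and the cost constraints leave only a nonnegative cost. Hence the
binary points of the polyhedron are exactly the descriptions of feasible schedules (`Valid.uc_eq`).

For the convex hull, a flow is decomposed into binary flows in its support by peeling off paths
(`IsFlow.exists_binary`, `mem_convexHull_binary`). The decomposition lifts to the whole point: keep
the generation per unit of flow on every used interval and rescale it to the new flow. This map is
affine in the flow, returns the point at its own flow, and sends binary flows in the support to
feasible points (`rescale_comb`, `Feasible.rescale_edge`, `Feasible.rescale`), so the point is a
convex combination of points of `UC` (`Valid.D4_eq`).

The polyhedron is unbounded only because generation costs can grow. Capping them at a large constant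
stays feasible and leads into a compact part. If capping never increases the objective, a minimum
exists, and the convex hull description moves it to a binary point
(`Valid.exists_binary_minimizer`). Capping is harmless for `cost`, where `φ` has coefficient one,
and for any objective bounded below, since raising `φ` is a recession direction. -/

namespace Generator

variable {g : Generator}

/-! ### Values of families -/

theorem val_of_mem {α : Type} [DecidableEq α] {A : Finset α} (f : A → ℝ) {i : α} (h : i ∈ A) :
    val f i = f ⟨i, h⟩ := dif_pos h

theorem val_of_notMem {α : Type} [DecidableEq α] {A : Finset α} (f : A → ℝ) {i : α} (h : i ∉ A) :
    val f i = 0 := dif_neg h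

theorem val_add {α : Type} [DecidableEq α] {A : Finset α} (f f' : A → ℝ) (i : α) :
    val (f + f') i = val f i + val f' i := by
  unfold val; split_ifs <;> simp

theorem val_smul {α : Type} [DecidableEq α] {A : Finset α} (c : ℝ) (f : A → ℝ) (i : α) :
    val (c • f) i = c * val f i := by
  unfold val; split_ifs <;> simp

theorem continuous_val {α : Type} [DecidableEq α] {A : Finset α} (i : α) :
    Continuous fun f : A → ℝ => val f i := by
  unfold val; split_ifs <;> fun_prop

theorem w_add (p p' : g.Space) (k : ℕ) : g.w (p + p') k = g.w p k + g.w p' k := val_add _ _ _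
theorem y_add (p p' : g.Space) (t k : ℕ) : g.y (p + p') t k = g.y p t k + g.y p' t k :=
  val_add _ _ _
theorem z_add (p p' : g.Space) (k t : ℕ) : g.z (p + p') k t = g.z p k t + g.z p' k t :=
  val_add _ _ _
theorem theta_add (p p' : g.Space) (k : ℕ) : g.theta (p + p') k = g.theta p k + g.theta p' k :=
  val_add _ _ _
theorem q_add (p p' : g.Space) (t k s : ℕ) : g.q (p + p') t k s = g.q p t k s + g.q p' t k s :=
  val_add _ _ _
theorem phi_add (p p' : g.Space) (t k s : ℕ) :
    g.phi (p + p') t k s = g.phi p t k s + g.phi p' t k s := val_add _ _ _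

theorem w_smul (c : ℝ) (p : g.Space) (k : ℕ) : g.w (c • p) k = c * g.w p k := val_smul _ _ _
theorem y_smul (c : ℝ) (p : g.Space) (t k : ℕ) : g.y (c • p) t k = c * g.y p t k := val_smul _ _ _
theorem z_smul (c : ℝ) (p : g.Space) (k t : ℕ) : g.z (c • p) k t = c * g.z p k t := val_smul _ _ _
theorem theta_smul (c : ℝ) (p : g.Space) (k : ℕ) : g.theta (c • p) k = c * g.theta p k :=
  val_smul _ _ _
theorem q_smul (c : ℝ) (p : g.Space) (t k s : ℕ) : g.q (c • p) t k s = c * g.q p t k s :=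
  val_smul _ _ _
theorem phi_smul (c : ℝ) (p : g.Space) (t k s : ℕ) : g.phi (c • p) t k s = c * g.phi p t k s :=
  val_smul _ _ _

theorem continuous_w (k : ℕ) : Continuous fun p : g.Space => g.w p k :=
  (continuous_val k).comp (by fun_prop : Continuous fun p : g.Space => p.1)
theorem continuous_y (t k : ℕ) : Continuous fun p : g.Space => g.y p t k :=
  (continuous_val (t, k)).comp (by fun_prop : Continuous fun p : g.Space => p.2.1)
theorem continuous_z (k t : ℕ) : Continuous fun p : g.Space => g.z p k t :=
  (continuous_val (k, t)).comp (by fun_prop : Continuous fun p : g.Space => p.2.2.1)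
theorem continuous_theta (k : ℕ) : Continuous fun p : g.Space => g.theta p k :=
  (continuous_val k).comp (by fun_prop : Continuous fun p : g.Space => p.2.2.2.1)
theorem continuous_q (t k s : ℕ) : Continuous fun p : g.Space => g.q p t k s :=
  (continuous_val (t, k, s)).comp (by fun_prop : Continuous fun p : g.Space => p.2.2.2.2.1)
theorem continuous_phi (t k s : ℕ) : Continuous fun p : g.Space => g.phi p t k s :=
  (continuous_val (t, k, s)).comp (by fun_prop : Continuous fun p : g.Space => p.2.2.2.2.2)

/-! ### Index sets -/

theorem Valid.one_le_minUp (hg : g.Valid) (t : ℕ) : 1 ≤ g.minUp t := by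
  unfold minUp; split_ifs; exacts [hg.one_le_L, le_rfl]

theorem Valid.one_le_minDown (hg : g.Valid) (k t : ℕ) : 1 ≤ g.minDown k t := by
  unfold minDown; split_ifs; exacts [hg.one_le_ell, le_rfl]

theorem mem_Kbar {k : ℕ} : k ∈ g.Kbar ↔ g.t0 ≤ k ∧ k ≤ g.Lmax - g.s0 ∧ k ≤ g.T := by
  simp [Kbar]

theorem mem_KT {k t : ℕ} : (k, t) ∈ g.KT ↔ g.t0 ≤ k ∧ k + g.minDown k t + 1 ≤ t ∧ t ≤ g.T := by
  simp only [KT, Finset.mem_filter, Finset.mem_product, Finset.mem_Icc]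
  omega

theorem mem_Starts {t : ℕ} : t ∈ g.Starts ↔ ∃ k, (k, t) ∈ g.KT := by
  simp [Starts]

theorem mem_ThetaIdx {k : ℕ} : k ∈ g.ThetaIdx ↔ g.t0 ≤ k ∧ k < g.T := by
  simp [ThetaIdx]

theorem mem_TK1 {t k : ℕ} : (t, k) ∈ g.TK1 ↔ t = 1 ∧ 1 ≤ k ∧ k ∈ g.Kbar := by
  simp only [TK1, Finset.mem_product, Finset.mem_singleton, Finset.mem_Icc, mem_Kbar]
  omega

theorem Valid.off_bounds (hg : g.Valid) {k t : ℕ} (h : (k, t) ∈ g.KT) :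
    g.t0 ≤ k ∧ k + 2 ≤ t ∧ t ≤ g.T := by
  have := hg.one_le_minDown k t
  have := mem_KT.1 h
  omega

theorem Valid.start_bounds (hg : g.Valid) {t : ℕ} (h : t ∈ g.Starts) :
    g.t0 + 2 ≤ t ∧ t ≤ g.T := by
  obtain ⟨k, hk⟩ := mem_Starts.1 h
  have := hg.off_bounds hk
  omega

/-- The truncation at `T` in the lower limit is what exempts an interval lasting through `T` from
the min-up time; `t ≤ k` follows because the effective min-up time is at least one. -/
theorem Valid.mem_TK2 (hg : g.Valid) {t k : ℕ} : (t, k) ∈ g.TK2 ↔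
    t ∈ g.Starts ∧ t ≤ k ∧ k ≤ g.T ∧ (k < g.T → g.minUp t ≤ k - t + 1) ∧ k - t + 1 ≤ g.Lmax := by
  simp only [TK2, Finset.mem_filter, Finset.mem_product, Finset.mem_Icc]
  have := hg.one_le_minUp t
  have := hg.L_le_Lmax
  have := hg.one_le_L
  constructor
  · rintro ⟨⟨h1, h2⟩, h3, h4⟩
    have := hg.start_bounds h1
    refine ⟨h1, ?_⟩
    omega
  · rintro ⟨h1, h2⟩
    have := hg.start_bounds h1
    refine ⟨⟨h1, ?_⟩, ?_⟩ <;> omega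

theorem Valid.on_bounds (hg : g.Valid) {t k : ℕ} (h : (t, k) ∈ g.TK2) :
    g.t0 + 2 ≤ t ∧ t ≤ k ∧ k ≤ g.T := by
  have h := hg.mem_TK2.1 h
  have := hg.start_bounds h.1
  omega

/-! ### The flow part of the constraints -/

/-- The constraints that involve `w`, `y`, `z` and `θ` only. -/
structure IsFlow (g : Generator) (p : g.Space) : Prop where
  first : ∑ k ∈ g.Kbar, g.w p k = 1
  balance_down : ∀ t' ∈ g.ThetaIdx,
    -g.w p t' + ∑ i ∈ g.KT with i.1 = t', g.z p i.1 i.2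
      - ∑ i ∈ g.TK2 with i.2 = t', g.y p i.1 i.2 + g.theta p t' = 0
  balance_up : ∀ t' ∈ g.Starts,
    ∑ i ∈ g.TK2 with i.1 = t', g.y p i.1 i.2 - ∑ i ∈ g.KT with i.2 = t', g.z p i.1 i.2 = 0
  w_nonneg : ∀ k ∈ g.Kbar, 0 ≤ g.w p k
  y_nonneg : ∀ i ∈ g.TK2, 0 ≤ g.y p i.1 i.2
  z_nonneg : ∀ i ∈ g.KT, 0 ≤ g.z p i.1 i.2
  theta_nonneg : ∀ k ∈ g.ThetaIdx, 0 ≤ g.theta p k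

theorem Feasible.isFlow {p : g.Space} (h : g.Feasible p) : g.IsFlow p :=
  ⟨h.first, h.balance_down, h.balance_up, h.w_nonneg, h.y_nonneg, h.z_nonneg, h.theta_nonneg⟩

/-- The edges of the flow network. -/
abbrev Edge (g : Generator) : Type := g.Kbar ⊕ g.TK2 ⊕ g.KT ⊕ g.ThetaIdx

/-- The flow on an edge. -/
def edge (p : g.Space) : g.Edge → ℝ :=
  Sum.elim p.1 (Sum.elim p.2.1 (Sum.elim p.2.2.1 p.2.2.2.1))

/-- The on- or off-interval of the edge contains the period `s`. -/
def Covers : g.Edge → ℕ → Prop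
  | .inl k, s => s ≤ k.1
  | .inr (.inl i), s => i.1.1 ≤ s ∧ s ≤ i.1.2
  | .inr (.inr (.inl i)), s => i.1.1 < s ∧ s < i.1.2
  | .inr (.inr (.inr k)), s => k.1 < s

theorem edge_w (p : g.Space) {k : ℕ} (h : k ∈ g.Kbar) : edge p (.inl ⟨k, h⟩) = g.w p k :=
  (val_of_mem p.1 h).symm
theorem edge_y (p : g.Space) {t k : ℕ} (h : (t, k) ∈ g.TK2) :
    edge p (.inr (.inl ⟨(t, k), h⟩)) = g.y p t k := (val_of_mem p.2.1 h).symm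
theorem edge_z (p : g.Space) {k t : ℕ} (h : (k, t) ∈ g.KT) :
    edge p (.inr (.inr (.inl ⟨(k, t), h⟩))) = g.z p k t := (val_of_mem p.2.2.1 h).symm
theorem edge_theta (p : g.Space) {k : ℕ} (h : k ∈ g.ThetaIdx) :
    edge p (.inr (.inr (.inr ⟨k, h⟩))) = g.theta p k := (val_of_mem p.2.2.2.1 h).symm

theorem w_of_notMem (p : g.Space) {k : ℕ} (h : k ∉ g.Kbar) : g.w p k = 0 := val_of_notMem _ h
theorem y_of_notMem (p : g.Space) {t k : ℕ} (h : (t, k) ∉ g.TK2) : g.y p t k = 0 :=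
  val_of_notMem _ h
theorem z_of_notMem (p : g.Space) {k t : ℕ} (h : (k, t) ∉ g.KT) : g.z p k t = 0 :=
  val_of_notMem _ h
theorem theta_of_notMem (p : g.Space) {k : ℕ} (h : k ∉ g.ThetaIdx) : g.theta p k = 0 :=
  val_of_notMem _ h

/-! ### Conservation of flow and cuts by period -/

theorem IsFlow.edge_nonneg {p : g.Space} (h : g.IsFlow p) (e : g.Edge) : 0 ≤ edge p e := by
  rcases e with k | i | i | k
  · rw [edge_w]; exact h.w_nonneg _ k.2
  · obtain ⟨⟨t, k⟩, hi⟩ := i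
    rw [edge_y]; exact h.y_nonneg _ hi
  · obtain ⟨⟨k, t⟩, hi⟩ := i
    rw [edge_z]; exact h.z_nonneg _ hi
  · rw [edge_theta]; exact h.theta_nonneg _ k.2

/-- Conservation is imposed only from `t0` on, but before `t0` no on-interval ends and no
off-interval begins, so every term vanishes there. -/
theorem IsFlow.balance_down' (hg : g.Valid) {p : g.Space} (h : g.IsFlow p) {s : ℕ} (hs : s < g.T) :
    ∑ i ∈ g.KT with i.1 = s, g.z p i.1 i.2 + g.theta p s
      = g.w p s + ∑ i ∈ g.TK2 with i.2 = s, g.y p i.1 i.2 := by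
  by_cases hm : s ∈ g.ThetaIdx
  · linarith [h.balance_down s hm]
  · rw [mem_ThetaIdx] at hm
    rw [w_of_notMem p (by rw [mem_Kbar]; omega), theta_of_notMem p (by rw [mem_ThetaIdx]; omega),
      Finset.filter_eq_empty_iff.2, Finset.filter_eq_empty_iff.2]
    · simp
    · rintro ⟨t, k⟩ hi rfl
      have := hg.on_bounds hi
      omega
    · rintro ⟨k, t⟩ hi rfl
      have := hg.off_bounds hi
      omega

theorem IsFlow.balance_up' (hg : g.Valid) {p : g.Space} (h : g.IsFlow p) (s : ℕ) :
    ∑ i ∈ g.TK2 with i.1 = s, g.y p i.1 i.2 = ∑ i ∈ g.KT with i.2 = s, g.z p i.1 i.2 := by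
  by_cases hm : s ∈ g.Starts
  · linarith [h.balance_up s hm]
  · rw [Finset.filter_eq_empty_iff.2, Finset.filter_eq_empty_iff.2, Finset.sum_empty,
      Finset.sum_empty]
    · rintro ⟨k, t⟩ hi rfl
      exact hm (mem_Starts.2 ⟨k, hi⟩)
    · rintro ⟨t, k⟩ hi rfl
      exact hm (hg.mem_TK2.1 hi).1

/-- Total flow on the edges whose intervals contain `s`. -/
noncomputable def cut (p : g.Space) (s : ℕ) : ℝ :=
  ∑ k ∈ g.Kbar, (if s ≤ k then g.w p k else 0)
    + ∑ i ∈ g.TK2, (if i.1 ≤ s ∧ s ≤ i.2 then g.y p i.1 i.2 else 0)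
    + ∑ i ∈ g.KT, (if i.1 < s ∧ s < i.2 then g.z p i.1 i.2 else 0)
    + ∑ k ∈ g.ThetaIdx, (if k < s then g.theta p k else 0)

/-- From `s` to `s + 1`, on-intervals ending at `s` are exchanged for off-intervals beginning after
`s`, and off-intervals before a start-up at `s + 1` for on-intervals beginning there. Both exchanges
are balanced by conservation. The argument needs every on- and off-interval to be nonempty. -/
theorem IsFlow.cut_succ (hg : g.Valid) {p : g.Space} (h : g.IsFlow p) {s : ℕ} (hs : s < g.T) :
    cut p (s + 1) = cut p s := by
  have hd := h.balance_down' hg hs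
  have hu := h.balance_up' hg (s + 1)
  have ew : ∑ k ∈ g.Kbar, (if s + 1 ≤ k then g.w p k else 0) + g.w p s
      = ∑ k ∈ g.Kbar, (if s ≤ k then g.w p k else 0) := by
    have : g.w p s = ∑ k ∈ g.Kbar, if k = s then g.w p k else 0 := by
      rw [Finset.sum_ite_eq']
      split_ifs with hm
      exacts [rfl, w_of_notMem p hm]
    rw [this, ← Finset.sum_add_distrib]
    refine Finset.sum_congr rfl fun k _ => ?_
    split_ifs <;> first | omega | simp
  have et : ∑ k ∈ g.ThetaIdx, (if k < s + 1 then g.theta p k else 0)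
      = ∑ k ∈ g.ThetaIdx, (if k < s then g.theta p k else 0) + g.theta p s := by
    have : g.theta p s = ∑ k ∈ g.ThetaIdx, if k = s then g.theta p k else 0 := by
      rw [Finset.sum_ite_eq']
      split_ifs with hm
      exacts [rfl, theta_of_notMem p hm]
    rw [this, ← Finset.sum_add_distrib]
    refine Finset.sum_congr rfl fun k _ => ?_
    split_ifs <;> first | omega | simp
  have ey : ∑ i ∈ g.TK2, (if i.1 ≤ s + 1 ∧ s + 1 ≤ i.2 then g.y p i.1 i.2 else 0)
      + ∑ i ∈ g.TK2 with i.2 = s, g.y p i.1 i.2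
      = ∑ i ∈ g.TK2, (if i.1 ≤ s ∧ s ≤ i.2 then g.y p i.1 i.2 else 0)
      + ∑ i ∈ g.TK2 with i.1 = s + 1, g.y p i.1 i.2 := by
    rw [Finset.sum_filter, Finset.sum_filter, ← Finset.sum_add_distrib, ← Finset.sum_add_distrib]
    refine Finset.sum_congr rfl fun ⟨t, k⟩ hi => ?_
    have := hg.on_bounds hi
    dsimp only
    split_ifs <;> first | omega | simp
  have ez : ∑ i ∈ g.KT, (if i.1 < s + 1 ∧ s + 1 < i.2 then g.z p i.1 i.2 else 0)
      + ∑ i ∈ g.KT with i.2 = s + 1, g.z p i.1 i.2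
      = ∑ i ∈ g.KT, (if i.1 < s ∧ s < i.2 then g.z p i.1 i.2 else 0)
      + ∑ i ∈ g.KT with i.1 = s, g.z p i.1 i.2 := by
    rw [Finset.sum_filter, Finset.sum_filter, ← Finset.sum_add_distrib, ← Finset.sum_add_distrib]
    refine Finset.sum_congr rfl fun ⟨k, t⟩ hi => ?_
    have := hg.off_bounds hi
    dsimp only
    split_ifs <;> first | omega | simp
  unfold cut
  linarith

theorem IsFlow.cut_eq_one (hg : g.Valid) {p : g.Space} (h : g.IsFlow p) {s : ℕ} (hs : s ≤ g.T) :
    cut p s = 1 := by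
  induction s with
  -- Period `0` is covered by the `w` edges alone, whose total flow is one.
  | zero =>
    unfold cut
    rw [Finset.sum_eq_zero (s := g.TK2), Finset.sum_eq_zero (s := g.KT),
      Finset.sum_eq_zero (s := g.ThetaIdx)]
    · simpa using h.first
    · simp
    · simp
    · rintro ⟨t, k⟩ hi
      have := hg.on_bounds hi
      rw [if_neg]
      dsimp only
      omega
  | succ s ih => rw [h.cut_succ hg (by omega), ih (by omega)]

open Classical in
theorem sum_covers (p : g.Space) (s : ℕ) :
    ∑ e : g.Edge, (if Covers e s then edge p e else 0) = cut p s := by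
  rw [Fintype.sum_sum_type, Fintype.sum_sum_type, Fintype.sum_sum_type, cut,
    ← Finset.sum_coe_sort g.Kbar, ← Finset.sum_coe_sort g.TK2, ← Finset.sum_coe_sort g.KT,
    ← Finset.sum_coe_sort g.ThetaIdx, add_assoc, add_assoc]
  refine congrArg₂ _ ?_ (congrArg₂ _ ?_ (congrArg₂ _ ?_ ?_)) <;>
    refine Finset.sum_congr rfl fun x _ => if_congr Iff.rfl ?_ rfl
  exacts [edge_w p x.2, edge_y p x.2, edge_z p x.2, edge_theta p x.2]

theorem IsFlow.edge_add_le_one (hg : g.Valid) {p : g.Space} (h : g.IsFlow p) {s : ℕ}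
    (hs : s ≤ g.T) {e e' : g.Edge} (he : Covers e s) (he' : Covers e' s) (hne : e ≠ e') :
    edge p e + edge p e' ≤ 1 := by
  classical
  rw [← h.cut_eq_one hg hs, ← sum_covers, ← Finset.sum_pair hne]
  calc ∑ x ∈ {e, e'}, edge p x = ∑ x ∈ {e, e'}, (if Covers x s then edge p x else 0) := by
        refine Finset.sum_congr rfl fun x hx => ?_
        rw [if_pos]
        rcases Finset.mem_insert.1 hx with rfl | hx
        exacts [he, Finset.mem_singleton.1 hx ▸ he']
    _ ≤ _ := Finset.sum_le_univ_sum_of_nonneg fun x => by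
        split_ifs
        exacts [h.edge_nonneg x, le_rfl]

/-- Every edge is used up to a flow of at most one. -/
theorem IsFlow.edge_le_one (hg : g.Valid) {p : g.Space} (h : g.IsFlow p) (e : g.Edge) :
    edge p e ≤ 1 := by
  classical
  obtain ⟨s, hs, he⟩ : ∃ s ≤ g.T, Covers e s := by
    rcases e with k | ⟨⟨t, k⟩, hi⟩ | ⟨⟨k, t⟩, hi⟩ | k
    · exact ⟨0, Nat.zero_le _, Nat.zero_le _⟩
    · have := hg.on_bounds hi
      exact ⟨t, by omega, by simp only [Covers]; omega⟩
    · have := hg.off_bounds hi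
      exact ⟨k + 1, by omega, by simp only [Covers]; omega⟩
    · have := mem_ThetaIdx.1 k.2
      exact ⟨k + 1, by omega, by simp only [Covers]; omega⟩
  rw [← h.cut_eq_one hg hs, ← sum_covers]
  calc edge p e = if Covers e s then edge p e else 0 := (if_pos he).symm
    _ ≤ _ := Finset.single_le_sum (f := fun e => if Covers e s then edge p e else 0)
        (fun x _ => by
          split_ifs
          exacts [h.edge_nonneg x, le_rfl]) (Finset.mem_univ e)

/-- Two different edges with flow one do not cover the same period. -/
theorem IsFlow.edge_unique (hg : g.Valid) {p : g.Space} (h : g.IsFlow p) {s : ℕ}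
    (hs : s ≤ g.T) {e e' : g.Edge} (h1 : edge p e = 1) (h1' : edge p e' = 1) (he : Covers e s)
    (he' : Covers e' s) : e = e' := by
  by_contra hne
  linarith [h.edge_add_le_one hg hs he he' hne]

end Generator

/-- A set of nonnegative vectors that is closed under affine combinations as long as they stay
nonnegative lies in the convex hull of its binary vectors, provided that every vector of the set
supports a binary one. -/
theorem mem_convexHull_binary {ι : Type*} [Fintype ι] {K : Set (ι → ℝ)}
    (h0 : ∀ f ∈ K, ∀ i, 0 ≤ f i) (h1 : ∀ f ∈ K, ∀ i, f i ≤ 1)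
    (hK : ∀ f ∈ K, ∀ P ∈ K, ∀ c : ℝ, (∀ i, 0 ≤ f i + c * (f i - P i)) → f + c • (f - P) ∈ K)
    (hP : ∀ f ∈ K, ∃ P ∈ K, (∀ i, P i = 0 ∨ P i = 1) ∧ ∀ i, P i ≠ 0 → f i ≠ 0)
    (f : ι → ℝ) (hf : f ∈ K) :
    f ∈ convexHull ℝ {P | P ∈ K ∧ (∀ i, P i = 0 ∨ P i = 1) ∧ ∀ i, P i ≠ 0 → f i ≠ 0} := by
  classical
  induction hn : (Finset.univ.filter fun i => f i ≠ 0).card using Nat.strong_induction_on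
    generalizing f with
  | _ n ih =>
  obtain ⟨P, hPK, hPb, hPs⟩ := hP f hf
  by_cases hfP : f = P
  · exact subset_convexHull _ _ ⟨hf, hfP ▸ hPb, fun _ h => h⟩
  obtain ⟨i₁, hi₁, hlt⟩ : ∃ i, P i = 1 ∧ f i < 1 := by
    -- If `f` were one on all of `P`, it would carry extra flow at some `j` outside `P`. Moving away
    -- from `P` by `1 / f j` keeps all entries nonnegative and raises entry `j` to `f j + 1`, beyond
    -- the bound one.
    by_contra! hcon
    have heq : ∀ i, P i = 1 → f i = 1 := fun i hi => le_antisymm (h1 f hf i) (hcon i hi)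
    obtain ⟨j, hj⟩ := Function.ne_iff.1 hfP
    have hPj : P j = 0 := (hPb j).resolve_right fun h => hj (by rw [h, heq j h])
    have hfj : 0 < f j := lt_of_le_of_ne (h0 f hf j) fun h => hj (by rw [hPj, h])
    have hmem := hK f hf P hPK (1 / f j) fun i => by
      rcases hPb i with h | h
      · rw [h, sub_zero]
        have := h0 f hf i
        positivity
      · rw [h, heq i h]; norm_num
    have := h1 _ hmem j
    simp only [Pi.add_apply, Pi.smul_apply, Pi.sub_apply, smul_eq_mul, hPj, sub_zero] at this
    rw [one_div_mul_cancel hfj.ne'] at this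
    linarith
  -- The bottleneck of `P`: its value `ε` is the largest multiple of `P` that can be peeled off. The
  -- normalized remainder `(f - ε P) / (1 - ε)` vanishes at `i₀`, so its support is strictly
  -- smaller.
  obtain ⟨i₀, hi₀, hmin⟩ := Finset.exists_min_image (Finset.univ.filter fun i => P i = 1) f
    ⟨i₁, by simp [hi₁]⟩
  simp only [Finset.mem_filter, Finset.mem_univ, true_and] at hi₀ hmin
  have hε1 : f i₀ < 1 := (hmin i₁ hi₁).trans_lt hlt
  have hε0 : 0 < f i₀ := lt_of_le_of_ne (h0 f hf i₀) (hPs i₀ (by rw [hi₀]; norm_num)).symm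
  generalize hε : f i₀ = ε at *
  have h1ε : 0 < 1 - ε := by linarith
  have hval : ∀ i, f i + ε / (1 - ε) * (f i - P i) = (f i - ε * P i) / (1 - ε) := fun i => by
    field_simp
    ring
  have hmem := hK f hf P hPK (ε / (1 - ε)) fun i => by
    rw [hval]
    refine div_nonneg ?_ h1ε.le
    rcases hPb i with h | h
    · rw [h]; linarith [h0 f hf i]
    · rw [h]; linarith [hmin i h]
  set f' := f + (ε / (1 - ε)) • (f - P) with hf'
  have hval' : ∀ i, f' i = (f i - ε * P i) / (1 - ε) := hval
  have hsupp : ∀ i, f' i ≠ 0 → f i ≠ 0 := fun i hi h => hi <| by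
    have hPi : P i = 0 := by
      by_contra hne
      exact hPs i hne h
    rw [hval', h, hPi]
    simp
  have hcard : (Finset.univ.filter fun i => f' i ≠ 0).card < n := by
    rw [← hn]
    refine Finset.card_lt_card (Finset.ssubset_iff_of_subset ?_ |>.2 ⟨i₀, ?_, ?_⟩)
    · exact Finset.monotone_filter_right _ fun i _ => hsupp i
    · simp [hε, hε0.ne']
    · simp [hval', hε, hi₀]
  have hconv := ih _ hcard f' hmem rfl
  have hconv' := convexHull_mono (𝕜 := ℝ) (t := {P | P ∈ K ∧ (∀ i, P i = 0 ∨ P i = 1) ∧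
    ∀ i, P i ≠ 0 → f i ≠ 0}) (fun R hR => ⟨hR.1, hR.2.1, fun i hi => hsupp i (hR.2.2 i hi)⟩) hconv
  -- Reassembling: `f = (1 - ε) f' + ε P`.
  have hcomb := (convex_convexHull ℝ _) hconv' (subset_convexHull ℝ _ ⟨hPK, hPb, hPs⟩)
    h1ε.le hε0.le (by ring)
  convert hcomb using 1
  funext i
  simp only [Pi.add_apply, Pi.smul_apply, smul_eq_mul, hval']
  field_simp
  ring

/-! ### Decomposition of flows into binary flows -/

namespace Generator

variable {g : Generator}

/-- From every last on-period through which there is flow, a binary unit flow to the end of the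
horizon can be sent along edges with positive flow. -/
theorem IsFlow.exists_binary_from (hg : g.Valid) {p : g.Space} (h : g.IsFlow p) (k : ℕ)
    (hk : g.t0 ≤ k) (hkT : k ≤ g.T)
    (hpos : k < g.T → ∑ i ∈ g.KT with i.1 = k, g.z p i.1 i.2 + g.theta p k ≠ 0) :
    ∃ (Y Z : ℕ × ℕ → ℝ) (Θ : ℕ → ℝ),
      (∀ i, Y i = 0 ∨ Y i = 1) ∧ (∀ i, Z i = 0 ∨ Z i = 1) ∧ (∀ j, Θ j = 0 ∨ Θ j = 1) ∧
      (∀ i, Y i ≠ 0 → g.y p i.1 i.2 ≠ 0 ∧ k < i.1) ∧ (∀ i, Z i ≠ 0 → g.z p i.1 i.2 ≠ 0 ∧ k ≤ i.1) ∧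
      (∀ j, Θ j ≠ 0 → g.theta p j ≠ 0) ∧
      (∀ s < g.T, ∑ i ∈ g.KT with i.1 = s, Z i + Θ s
        = (if s = k then 1 else 0) + ∑ i ∈ g.TK2 with i.2 = s, Y i) ∧
      ∀ s, ∑ i ∈ g.TK2 with i.1 = s, Y i = ∑ i ∈ g.KT with i.2 = s, Z i := by
  induction hn : g.T - k using Nat.strong_induction_on generalizing k with
  | _ n ih =>
  rcases hkT.eq_or_lt with rfl | hlt
  · refine ⟨0, 0, 0, ?_⟩
    simp only [Pi.zero_apply, Finset.sum_const_zero]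
    simp
    exact fun s hs hs' => absurd hs' hs.ne
  -- With flow on `θ k` the path stops here. Otherwise it follows an off-interval with positive flow
  -- and then an on-interval with positive flow, to a later `k'`.
  by_cases hθ : g.theta p k = 0
  · have hz : ∑ i ∈ g.KT with i.1 = k, g.z p i.1 i.2 ≠ 0 := by simpa [hθ] using hpos hlt
    obtain ⟨⟨k₀, t⟩, hzm, hzi⟩ := Finset.exists_ne_zero_of_sum_ne_zero hz
    obtain ⟨hi, hk₀⟩ := Finset.mem_filter.1 hzm
    obtain rfl : k₀ = k := hk₀
    have hb := hg.off_bounds hi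
    have hy : ∑ i ∈ g.TK2 with i.1 = t, g.y p i.1 i.2 ≠ 0 := by
      rw [h.balance_up' hg]
      refine (Finset.sum_pos' (fun i hi => h.z_nonneg i (Finset.mem_filter.1 hi).1)
        ⟨(k₀, t), by simp [hi], lt_of_le_of_ne (h.z_nonneg _ hi) (Ne.symm hzi)⟩).ne'
    obtain ⟨⟨t₀, k'⟩, hym, hyi⟩ := Finset.exists_ne_zero_of_sum_ne_zero hy
    obtain ⟨hi', ht₀⟩ := Finset.mem_filter.1 hym
    obtain rfl : t₀ = t := ht₀
    have hb' := hg.on_bounds hi'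
    -- The on-interval just chosen brings positive flow into `k'`, so by conservation positive flow
    -- leaves it.
    obtain ⟨Y, Z, Θ, bY, bZ, bΘ, sY, sZ, sΘ, dn, up⟩ := ih (g.T - k') (by omega) k' (by omega)
      (by omega) (fun hk' => by
        rw [h.balance_down' hg hk']
        have h1 : 0 < ∑ i ∈ g.TK2 with i.2 = k', g.y p i.1 i.2 :=
          Finset.sum_pos' (fun i hi => h.y_nonneg i (Finset.mem_filter.1 hi).1)
            ⟨(t₀, k'), by simp [hi'], lt_of_le_of_ne (h.y_nonneg _ hi') (Ne.symm hyi)⟩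
        have h2 : 0 ≤ g.w p k' := by
          by_cases hm : k' ∈ g.Kbar
          exacts [h.w_nonneg _ hm, (w_of_notMem p hm).ge]
        linarith) rfl
    -- The path from `k'` uses only later edges, so adding the two new ones keeps `Y` and `Z`
    -- binary.
    have hY : Y (t₀, k') = 0 := by
      by_contra hne
      have := (sY _ hne).2
      dsimp only at this
      omega
    have hZ : Z (k₀, t₀) = 0 := by
      by_contra hne
      have := (sZ _ hne).2
      dsimp only at this
      omega
    refine ⟨fun i => Y i + if i = (t₀, k') then 1 else 0,
      fun i => Z i + if i = (k₀, t₀) then 1 else 0, Θ, ?_, ?_, bΘ, ?_, ?_, sΘ, ?_, ?_⟩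
    · intro i
      dsimp only
      split_ifs with he
      · subst he; simp [hY]
      · simpa using bY i
    · intro i
      dsimp only
      split_ifs with he
      · subst he; simp [hZ]
      · simpa using bZ i
    · intro i
      dsimp only
      split_ifs with he
      · subst he
        exact fun _ => ⟨hyi, by dsimp only; omega⟩
      · intro hne
        obtain ⟨h1, h2⟩ := sY i (by simpa using hne)
        exact ⟨h1, by omega⟩
    · intro i
      dsimp only
      split_ifs with he
      · subst he
        exact fun _ => ⟨hzi, le_rfl⟩
      · intro hne
        obtain ⟨h1, h2⟩ := sZ i (by simpa using hne)
        exact ⟨h1, by omega⟩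
    · intro s hs
      have := dn s hs
      simp only [Finset.sum_add_distrib, Finset.sum_ite_eq', Finset.mem_filter, hi, hi', true_and,
        eq_comm (a := s)] at this ⊢
      linarith
    · intro s
      simp only [Finset.sum_add_distrib, Finset.sum_ite_eq', Finset.mem_filter, hi, hi', true_and,
        up s]
  · refine ⟨0, 0, fun j => if j = k then 1 else 0, by simp, by simp, ?_, by simp, by simp, ?_,
      by simp, by simp⟩
    · intro j
      dsimp only
      split_ifs <;> simp
    · intro j
      dsimp only
      split_ifs with he
      · subst he; exact fun _ => hθ
      · simp

/-- The point with given flow and without generation. -/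
def ofEdge (F : g.Edge → ℝ) : g.Space :=
  (fun k => F (.inl k), fun i => F (.inr (.inl i)), fun i => F (.inr (.inr (.inl i))),
    fun k => F (.inr (.inr (.inr k))), 0, 0)

theorem edge_ofEdge (F : g.Edge → ℝ) : edge (ofEdge F) = F := by
  funext e
  rcases e with e | e | e | e <;> rfl

theorem IsFlow.ofEdge {p : g.Space} (h : g.IsFlow p) : g.IsFlow (ofEdge (edge p)) :=
  ⟨h.first, h.balance_down, h.balance_up, h.w_nonneg, h.y_nonneg, h.z_nonneg, h.theta_nonneg⟩

/-- Every flow supports a binary flow. -/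
theorem IsFlow.exists_binary (hg : g.Valid) {p : g.Space} (h : g.IsFlow p) :
    ∃ P : g.Space, g.IsFlow P ∧ (∀ e, edge P e = 0 ∨ edge P e = 1) ∧
      ∀ e, edge P e ≠ 0 → edge p e ≠ 0 := by
  obtain ⟨k, hk, hwk⟩ := Finset.exists_ne_zero_of_sum_ne_zero
    (by rw [h.first]; exact one_ne_zero : ∑ k ∈ g.Kbar, g.w p k ≠ 0)
  have hb := mem_Kbar.1 hk
  obtain ⟨Y, Z, Θ, bY, bZ, bΘ, sY, sZ, sΘ, dn, up⟩ := h.exists_binary_from hg k hb.1 hb.2.2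
    fun hkT => by
      rw [h.balance_down' hg hkT]
      have h1 := lt_of_le_of_ne (h.w_nonneg k hk) (Ne.symm hwk)
      have h2 : 0 ≤ ∑ i ∈ g.TK2 with i.2 = k, g.y p i.1 i.2 :=
        Finset.sum_nonneg fun i hi => h.y_nonneg i (Finset.mem_filter.1 hi).1
      linarith
  have nn : ∀ {r : ℝ}, r = 0 ∨ r = 1 → 0 ≤ r := by
    rintro r (rfl | rfl) <;> norm_num
  let P : g.Space := (fun j => if j.1 = k then 1 else 0, fun i => Y i, fun i => Z i, fun j => Θ j,
    0, 0)
  have hw : ∀ j, g.w P j = if j = k then 1 else 0 := fun j => by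
    by_cases hj : j ∈ g.Kbar
    · exact val_of_mem _ hj
    · rw [w_of_notMem _ hj, if_neg]
      rintro rfl
      exact hj hk
  have hy : ∀ i ∈ g.TK2, g.y P i.1 i.2 = Y i := fun i hi => val_of_mem _ hi
  have hz : ∀ i ∈ g.KT, g.z P i.1 i.2 = Z i := fun i hi => val_of_mem _ hi
  have hθ : ∀ j ∈ g.ThetaIdx, g.theta P j = Θ j := fun i hi => val_of_mem _ hi
  have sumY : ∀ (c : ℕ × ℕ → Prop) [DecidablePred c],
      ∑ i ∈ g.TK2 with c i, g.y P i.1 i.2 = ∑ i ∈ g.TK2 with c i, Y i := fun c _ =>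
    Finset.sum_congr rfl fun i hi => hy i (Finset.mem_filter.1 hi).1
  have sumZ : ∀ (c : ℕ × ℕ → Prop) [DecidablePred c],
      ∑ i ∈ g.KT with c i, g.z P i.1 i.2 = ∑ i ∈ g.KT with c i, Z i := fun c _ =>
    Finset.sum_congr rfl fun i hi => hz i (Finset.mem_filter.1 hi).1
  refine ⟨P, ⟨?_, ?_, ?_, ?_, ?_, ?_, ?_⟩, ?_, ?_⟩
  · simp [hw, hk]
  · intro s hs
    have := dn s (mem_ThetaIdx.1 hs).2
    rw [hw, sumY, sumZ, hθ s hs]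
    linarith
  · intro s _
    rw [sumY, sumZ, up, sub_self]
  · intro j _
    rw [hw]
    split_ifs <;> norm_num
  · exact fun i hi => by rw [hy i hi]; exact nn (bY i)
  · exact fun i hi => by rw [hz i hi]; exact nn (bZ i)
  · exact fun i hi => by rw [hθ i hi]; exact nn (bΘ i)
  · rintro (j | i | i | j)
    · change (if j.1 = k then (1 : ℝ) else 0) = 0 ∨ (if j.1 = k then (1 : ℝ) else 0) = 1
      split_ifs <;> simp
    exacts [bY i, bZ i, bΘ j]
  · rintro (⟨j, hj⟩ | i | i | j)
    · change (if j = k then (1 : ℝ) else 0) ≠ 0 → _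
      split_ifs with he
      · subst he
        exact fun _ => by rwa [edge_w]
      · simp
    · exact fun hne => by
        have := (sY i hne).1
        rwa [← edge_y p i.2] at this
    · exact fun hne => by
        have := (sZ i hne).1
        rwa [← edge_z p i.2] at this
    · exact fun hne => by
        have := sΘ j hne
        rwa [← edge_theta p j.2] at this

/-- The coefficients `1 + c` and `-c` sum to one, so all equations, including the inhomogeneous one,
survive; only nonnegativity has to be assumed. -/
theorem IsFlow.add_smul_sub {p p' : g.Space} (h : g.IsFlow p) (h' : g.IsFlow p') (c : ℝ)
    (hc : ∀ e, 0 ≤ edge (p + c • (p - p')) e) : g.IsFlow (p + c • (p - p')) := by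
  have hsub : p - p' = p + (-1 : ℝ) • p' := by rw [neg_one_smul, sub_eq_add_neg]
  refine ⟨?_, ?_, ?_, ?_, ?_, ?_, ?_⟩
  · simp only [hsub, w_add, w_smul, Finset.sum_add_distrib, ← Finset.mul_sum, h.first, h'.first]
    ring
  · intro s hs
    have h1 := h.balance_down s hs
    have h2 := h'.balance_down s hs
    simp only [hsub, w_add, w_smul, y_add, y_smul, z_add, z_smul, theta_add, theta_smul,
      Finset.sum_add_distrib, ← Finset.mul_sum]
    linear_combination (1 + c) * h1 - c * h2
  · intro s hs
    have h1 := h.balance_up s hs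
    have h2 := h'.balance_up s hs
    simp only [hsub, y_add, y_smul, z_add, z_smul, Finset.sum_add_distrib, ← Finset.mul_sum]
    linear_combination (1 + c) * h1 - c * h2
  · exact fun k hk => by rw [← edge_w _ hk]; exact hc _
  · exact fun i hi => by rw [← edge_y _ hi]; exact hc _
  · exact fun i hi => by rw [← edge_z _ hi]; exact hc _
  · exact fun k hk => by rw [← edge_theta _ hk]; exact hc _

/-- The flow of a point is a convex combination of binary flows in its support. -/
theorem IsFlow.edge_mem_convexHull (hg : g.Valid) {p : g.Space} (h : g.IsFlow p) :
    edge p ∈ convexHull ℝ {P : g.Edge → ℝ | g.IsFlow (Generator.ofEdge P) ∧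
      (∀ e, P e = 0 ∨ P e = 1) ∧ ∀ e, P e ≠ 0 → edge p e ≠ 0} := by
  refine mem_convexHull_binary (K := {F | g.IsFlow (Generator.ofEdge F)}) ?_ ?_ ?_ ?_ _ h.ofEdge
  · intro F hF e
    have := IsFlow.edge_nonneg hF e
    rwa [edge_ofEdge] at this
  · intro F hF e
    have := IsFlow.edge_le_one hg hF e
    rwa [edge_ofEdge] at this
  · intro F hF P hP c hc
    have he : Generator.ofEdge (F + c • (F - P))
        = Generator.ofEdge F + c • (Generator.ofEdge F - Generator.ofEdge P) := by
      simp only [Generator.ofEdge]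
      ext <;> simp
    have hF' := IsFlow.add_smul_sub hF hP c
    rw [← he, edge_ofEdge] at hF'
    exact hF' hc
  · intro F hF
    obtain ⟨P, h1, h2, h3⟩ := IsFlow.exists_binary hg hF
    rw [edge_ofEdge] at h3
    exact ⟨edge P, h1.ofEdge, h2, h3⟩

variable {u : ℕ → Prop} {x f : ℕ → ℝ} {p : g.Space}

/-! ### Runs of a schedule -/

theorem exists_run_end {T t : ℕ} (ht : t ≤ T) (hu : u t) :
    ∃ k, t ≤ k ∧ k ≤ T ∧ (∀ s, t ≤ s → s ≤ k → u s) ∧ (k < T → ¬ u (k + 1)) := by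
  induction hn : T - t generalizing t with
  | zero =>
    refine ⟨t, le_rfl, ht, fun s h1 h2 => ?_, fun h => by omega⟩
    rwa [← le_antisymm h1 h2]
  | succ n ih =>
    by_cases h : u (t + 1)
    · obtain ⟨k, h1, h2, h3, h4⟩ := ih (by omega) h (by omega)
      refine ⟨k, by omega, h2, fun s hs hsk => ?_, h4⟩
      rcases hs.eq_or_lt with rfl | hlt
      exacts [hu, h3 s hlt hsk]
    · refine ⟨t, le_rfl, ht, fun s h1 h2 => ?_, fun _ => h⟩
      rwa [← le_antisymm h1 h2]

theorem exists_run_start {k : ℕ} (hu : u k) :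
    (∀ s, s ≤ k → u s) ∨ ∃ t, 1 ≤ t ∧ t ≤ k ∧ ¬ u (t - 1) ∧ ∀ s, t ≤ s → s ≤ k → u s := by
  induction k with
  | zero => exact .inl fun s hs => by rwa [Nat.le_zero.1 hs]
  | succ k ih =>
    by_cases h : u k
    · rcases ih h with h1 | ⟨t, h1, h2, h3, h4⟩
      · refine .inl fun s hs => ?_
        rcases hs.eq_or_lt with rfl | hlt
        exacts [hu, h1 s (by omega)]
      · refine .inr ⟨t, h1, by omega, h3, fun s hts hs => ?_⟩
        rcases hs.eq_or_lt with rfl | hlt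
        exacts [hu, h4 s hts (by omega)]
    · refine .inr ⟨k + 1, by omega, le_rfl, by simpa using h, fun s h1 h2 => ?_⟩
      rwa [← le_antisymm h1 h2]

theorem exists_off_start {s : ℕ} (h0 : u 0) (hs : ¬ u s) :
    ∃ k < s, u k ∧ ∀ r, k < r → r ≤ s → ¬ u r := by
  induction s with
  | zero => exact absurd h0 hs
  | succ s ih =>
    by_cases h : u s
    · refine ⟨s, by omega, h, fun r h1 h2 => ?_⟩
      rwa [le_antisymm h2 h1]
    · obtain ⟨k, h1, h2, h3⟩ := ih h
      refine ⟨k, by omega, h2, fun r hr hrs => ?_⟩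
      rcases hrs.eq_or_lt with rfl | hlt
      exacts [hs, h3 r hr (by omega)]

theorem exists_off_end {T k : ℕ} (hk : ¬ u (k + 1)) :
    (∀ s, k < s → s ≤ T → ¬ u s) ∨
      ∃ t, k + 1 < t ∧ t ≤ T ∧ (∀ s, k < s → s < t → ¬ u s) ∧ u t := by
  classical
  by_cases h : ∃ t, k < t ∧ t ≤ T ∧ u t
  · right
    obtain ⟨h1, h2, h3⟩ := Nat.find_spec h
    refine ⟨Nat.find h, ?_, h2, fun s hks hs hus => Nat.find_min h hs ⟨hks, by omega, hus⟩, h3⟩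
    refine lt_of_le_of_ne h1 fun he => ?_
    rw [← he] at h3
    exact hk h3
  · left
    push Not at h
    exact h

theorem InitialRun.unique {k k' : ℕ} (h : g.InitialRun u k) (h' : g.InitialRun u k') : k = k' := by
  obtain ⟨h1, h2, h3⟩ := h
  obtain ⟨h1', h2', h3'⟩ := h'
  rcases lt_trichotomy k k' with hlt | rfl | hlt
  · exact absurd (h2' (k + 1) hlt) (h3 (by omega))
  · rfl
  · exact absurd (h2 (k' + 1) hlt) (h3' (by omega))

theorem OnRun.end_unique {t k k' : ℕ} (h : g.OnRun u t k) (h' : g.OnRun u t k') : k = k' := by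
  obtain ⟨h1, h2, h3, h4, h5, h6⟩ := h
  obtain ⟨h1', h2', h3', h4', h5', h6'⟩ := h'
  rcases lt_trichotomy k k' with hlt | rfl | hlt
  · exact absurd (h5' (k + 1) (by omega) hlt) (h6 (by omega))
  · rfl
  · exact absurd (h5 (k' + 1) (by omega) hlt) (h6' (by omega))

theorem OnRun.start_unique {t t' k : ℕ} (h : g.OnRun u t k) (h' : g.OnRun u t' k) : t = t' := by
  obtain ⟨h1, h2, h3, h4, h5, h6⟩ := h
  obtain ⟨h1', h2', h3', h4', h5', h6'⟩ := h'
  rcases lt_trichotomy t t' with hlt | rfl | hlt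
  · exact absurd (h5 (t' - 1) (by omega) (by omega)) h4'
  · rfl
  · exact absurd (h5' (t - 1) (by omega) (by omega)) h4

theorem OnRun.not_initialRun {t k : ℕ} (h : g.OnRun u t k) : ¬ g.InitialRun u k := fun h' =>
  h.2.2.2.1 (h'.2.1 (t - 1) (by have := h.2.1; omega))

theorem OffRun.end_unique {k t t' : ℕ} (h : g.OffRun u k t) (h' : g.OffRun u k t') : t = t' := by
  obtain ⟨h1, h2, h3, h4, h5⟩ := h
  obtain ⟨h1', h2', h3', h4', h5'⟩ := h'
  rcases lt_trichotomy t t' with hlt | rfl | hlt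
  · exact absurd h5 (h4' t (by omega) hlt)
  · rfl
  · exact absurd h5' (h4 t' (by omega) hlt)

theorem OffRun.start_unique {k k' t : ℕ} (h : g.OffRun u k t) (h' : g.OffRun u k' t) : k = k' := by
  obtain ⟨h1, h2, h3, h4, h5⟩ := h
  obtain ⟨h1', h2', h3', h4', h5'⟩ := h'
  rcases lt_trichotomy k k' with hlt | rfl | hlt
  · exact absurd h3' (h4 k' hlt (by omega))
  · rfl
  · exact absurd h3 (h4' k hlt (by omega))

theorem OffRun.not_finalOff {k t : ℕ} (h : g.OffRun u k t) : ¬ g.FinalOff u k := fun h' =>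
  h'.2.2 t (by have := h.1; omega) h.2.1 h.2.2.2.2

theorem exists_initialRun (h0 : u 0) : ∃ k, g.InitialRun u k := by
  obtain ⟨k, -, h2, h3, h4⟩ := exists_run_end (Nat.zero_le g.T) h0
  exact ⟨k, h2, fun s hs => h3 s (Nat.zero_le _) hs, h4⟩

/-! ### Runs of feasible schedules are in the index sets -/

theorem Commitment.initialRun_mem (hg : g.Valid) (h : g.Commitment u) {k : ℕ}
    (hr : g.InitialRun u k) : k ∈ g.Kbar := by
  have h1 := h.first_up k hr
  have h2 := hr.1
  -- Needed when the initial run lasts through `T`: then the min-up time gives no information and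
  -- `t0 ≤ T` must come from the data.
  have := hg.L_le
  rw [mem_Kbar, t0]
  rcases h2.eq_or_lt with h3 | h3
  · omega
  · have := h1.1 h3
    omega

/-- The initial run reaches at least `t0`, so no period up to `t0` is off. -/
theorem Commitment.le_of_off (hg : g.Valid) (h : g.Commitment u) {k : ℕ} (hk : ¬ u (k + 1)) :
    g.t0 ≤ k := by
  obtain ⟨k₀, hr⟩ := exists_initialRun (g := g) h.initially_on
  have := (mem_Kbar.1 (h.initialRun_mem hg hr)).1
  by_contra! hlt
  exact hk (hr.2.1 (k + 1) (by omega))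

theorem Commitment.offRun_mem (hg : g.Valid) (h : g.Commitment u) {k t : ℕ}
    (hr : g.OffRun u k t) : (k, t) ∈ g.KT := by
  have h1 := h.down k t hr
  obtain ⟨h2, h3, h4, h5, h6⟩ := hr
  have := h.le_of_off hg (h5 (k + 1) (by omega) h2)
  rw [mem_KT]
  omega

theorem Commitment.exists_offRun (h : g.Commitment u) {t : ℕ} (h1 : 1 ≤ t) (hT : t ≤ g.T)
    (hu : u t) (hu' : ¬ u (t - 1)) : ∃ k, g.OffRun u k t := by
  obtain ⟨k, hk, huk, hoff⟩ := exists_off_start h.initially_on hu'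
  exact ⟨k, by omega, hT, huk, fun s h2 h3 => hoff s h2 (by omega), hu⟩

theorem exists_onRun {t : ℕ} (h1 : 1 ≤ t) (hT : t ≤ g.T) (hu : u t) (hu' : ¬ u (t - 1)) :
    ∃ k, g.OnRun u t k := by
  obtain ⟨k, h2, h3, h4, h5⟩ := exists_run_end hT hu
  exact ⟨k, h1, h2, h3, hu', h4, h5⟩

theorem Commitment.onRun_mem (hg : g.Valid) (h : g.Commitment u) {t k : ℕ}
    (hr : g.OnRun u t k) : (t, k) ∈ g.TK2 := by
  have h1 := h.later_up t k hr
  obtain ⟨h2, h3, h4, h5, h6, h7⟩ := hr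
  obtain ⟨k', hk'⟩ := h.exists_offRun h2 (by omega) (h6 t le_rfl h3) h5
  exact hg.mem_TK2.2 ⟨mem_Starts.2 ⟨k', h.offRun_mem hg hk'⟩, h3, h4, h1⟩

/-! ### Points that describe a feasible schedule satisfy the constraints -/

theorem IsIndicator.binary {P : Prop} {r : ℝ} (h : IsIndicator P r) : r = 0 ∨ r = 1 := by
  by_cases hP : P
  exacts [.inr (h.1 hP), .inl (h.2 hP)]

theorem IsIndicator.nonneg {P : Prop} {r : ℝ} (h : IsIndicator P r) : 0 ≤ r := by
  rcases h.binary with rfl | rfl <;> norm_num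

theorem sum_indicator_eq_one {α : Type} {A : Finset α} {P : α → Prop} {r : α → ℝ}
    (h : ∀ i ∈ A, IsIndicator (P i) (r i)) {i₀ : α} (hi₀ : i₀ ∈ A) (hP : P i₀)
    (huniq : ∀ i ∈ A, P i → i = i₀) : ∑ i ∈ A, r i = 1 := by
  rw [Finset.sum_eq_single_of_mem i₀ hi₀ fun i hi hne => (h i hi).2 fun hPi => hne (huniq i hi hPi)]
  exact (h i₀ hi₀).1 hP

theorem sum_indicator_eq_zero {α : Type} {A : Finset α} {P : α → Prop} {r : α → ℝ}
    (h : ∀ i ∈ A, IsIndicator (P i) (r i)) (hP : ∀ i ∈ A, ¬ P i) : ∑ i ∈ A, r i = 0 :=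
  Finset.sum_eq_zero fun i hi => (h i hi).2 (hP i hi)

/-- Runs of the schedule form a path. At the node after period `s`, inflow and outflow are both one
if the unit is on at `s` and off at `s + 1`, and both zero otherwise; start-up nodes are analogous.
Every run that occurs lies in the index sets, so no term is missing from the sums. -/
theorem Encodes.isFlow (hg : g.Valid) (hc : g.Commitment u) (he : g.Encodes p u x f) :
    g.IsFlow p := by
  have hy : ∀ (c : ℕ × ℕ → Prop) [DecidablePred c], ∀ i ∈ g.TK2.filter c,
      IsIndicator (g.OnRun u i.1 i.2) (g.y p i.1 i.2) :=
    fun c _ i hi => he.y_eq i (Finset.mem_filter.1 hi).1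
  have hz : ∀ (c : ℕ × ℕ → Prop) [DecidablePred c], ∀ i ∈ g.KT.filter c,
      IsIndicator (g.OffRun u i.1 i.2) (g.z p i.1 i.2) :=
    fun c _ i hi => he.z_eq i (Finset.mem_filter.1 hi).1
  have hw : ∀ s, IsIndicator (g.InitialRun u s) (g.w p s) := fun s => by
    by_cases hs : s ∈ g.Kbar
    · exact he.w_eq s hs
    · rw [w_of_notMem p hs]
      exact ⟨fun h => absurd (hc.initialRun_mem hg h) hs, fun _ => rfl⟩
  refine ⟨?_, ?_, ?_, fun k hk => (he.w_eq k hk).nonneg, fun i hi => (he.y_eq i hi).nonneg,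
    fun i hi => (he.z_eq i hi).nonneg, fun k hk => (he.theta_eq k hk).nonneg⟩
  · obtain ⟨k, hk⟩ := exists_initialRun (g := g) hc.initially_on
    exact sum_indicator_eq_one he.w_eq (hc.initialRun_mem hg hk) hk fun i _ hi => hi.unique hk
  · intro s hs
    have hsT := (mem_ThetaIdx.1 hs).2
    have hθ := he.theta_eq s hs
    by_cases hus : u s ∧ ¬ u (s + 1)
    · have hout : ∑ i ∈ g.KT with i.1 = s, g.z p i.1 i.2 + g.theta p s = 1 := by
        rcases exists_off_end (T := g.T) hus.2 with hfin | ⟨t, h1, h2, h3, h4⟩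
        · have hfin : g.FinalOff u s := ⟨hsT, hus.1, hfin⟩
          rw [hθ.1 hfin, sum_indicator_eq_zero (hz _), zero_add]
          rintro ⟨k, t⟩ hi hr
          obtain rfl := (Finset.mem_filter.1 hi).2
          exact hr.not_finalOff hfin
        · have hr : g.OffRun u s t := ⟨h1, h2, hus.1, h3, h4⟩
          rw [hθ.2 hr.not_finalOff, add_zero]
          refine sum_indicator_eq_one (hz _) (i₀ := (s, t))
            (Finset.mem_filter.2 ⟨hc.offRun_mem hg hr, rfl⟩) hr ?_
          rintro ⟨k, t'⟩ hi hr'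
          obtain rfl := (Finset.mem_filter.1 hi).2
          exact Prod.ext rfl (OffRun.end_unique hr' hr)
      have hin : g.w p s + ∑ i ∈ g.TK2 with i.2 = s, g.y p i.1 i.2 = 1 := by
        rcases exists_run_start hus.1 with hini | ⟨t, h1, h2, h3, h4⟩
        · have hini : g.InitialRun u s := ⟨hsT.le, hini, fun _ => hus.2⟩
          rw [(hw s).1 hini, sum_indicator_eq_zero (hy _), add_zero]
          rintro ⟨t, k⟩ hi hr
          obtain rfl := (Finset.mem_filter.1 hi).2
          exact hr.not_initialRun hini
        · have hr : g.OnRun u t s := ⟨h1, h2, hsT.le, h3, h4, fun _ => hus.2⟩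
          rw [(hw s).2 hr.not_initialRun, zero_add]
          refine sum_indicator_eq_one (hy _) (i₀ := (t, s))
            (Finset.mem_filter.2 ⟨hc.onRun_mem hg hr, rfl⟩) hr ?_
          rintro ⟨t', k⟩ hi hr'
          obtain rfl := (Finset.mem_filter.1 hi).2
          exact Prod.ext (OnRun.start_unique hr' hr) rfl
      linarith
    · rw [(hw s).2, hθ.2, sum_indicator_eq_zero (hz _), sum_indicator_eq_zero (hy _)]
      · simp
      · rintro ⟨t, k⟩ hi hr
        obtain rfl := (Finset.mem_filter.1 hi).2
        exact hus ⟨hr.2.2.2.2.1 _ hr.2.1 le_rfl, hr.2.2.2.2.2 hsT⟩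
      · rintro ⟨k, t⟩ hi hr
        obtain rfl := (Finset.mem_filter.1 hi).2
        exact hus ⟨hr.2.2.1, hr.2.2.2.1 _ (by omega) hr.1⟩
      · exact fun hr => hus ⟨hr.2.1, hr.2.2 _ (by omega) hsT⟩
      · exact fun hr => hus ⟨hr.2.1 _ le_rfl, hr.2.2 hsT⟩
  · intro s hs
    have hb := hg.start_bounds hs
    by_cases hus : u s ∧ ¬ u (s - 1)
    · obtain ⟨t, ht⟩ := exists_onRun (by omega) hb.2 hus.1 hus.2
      obtain ⟨k, hk⟩ := hc.exists_offRun (by omega) hb.2 hus.1 hus.2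
      rw [sum_indicator_eq_one (hy fun i => i.1 = s) (i₀ := (s, t))
          (Finset.mem_filter.2 ⟨hc.onRun_mem hg ht, rfl⟩) ht,
        sum_indicator_eq_one (hz fun i => i.2 = s) (i₀ := (k, s))
          (Finset.mem_filter.2 ⟨hc.offRun_mem hg hk, rfl⟩) hk, sub_self]
      · rintro ⟨k', t'⟩ hi hr'
        obtain rfl := (Finset.mem_filter.1 hi).2
        exact Prod.ext (OffRun.start_unique hr' hk) rfl
      · rintro ⟨t', k'⟩ hi hr'
        obtain rfl := (Finset.mem_filter.1 hi).2
        exact Prod.ext rfl (OnRun.end_unique hr' ht)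
    · rw [sum_indicator_eq_zero (hz _), sum_indicator_eq_zero (hy _), sub_self]
      · rintro ⟨t, k⟩ hi hr
        obtain rfl := (Finset.mem_filter.1 hi).2
        exact hus ⟨hr.2.2.2.2.1 _ le_rfl hr.2.1, hr.2.2.2.1⟩
      · rintro ⟨k, t⟩ hi hr
        obtain rfl := (Finset.mem_filter.1 hi).2
        exact hus ⟨hr.2.2.2.2, hr.2.2.2.1 _ (by have := hr.1; dsimp only at *; omega)
          (by dsimp only at *; omega)⟩

theorem Operation.dispatch (ho : g.Operation u x f) {t k : ℕ} {P : Prop} {r : ℝ}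
    (hc : g.Carries p x f t k P) (hr : IsIndicator P r) (ht : 1 ≤ t) (htk : t ≤ k) (hkT : k ≤ g.T)
    (hrun : P → (∀ s, t ≤ s → s ≤ k → u s) ∧ (k < g.T → ¬ u (k + 1))) :
    g.Dispatch p t k r := by
  by_cases hP : P
  · obtain ⟨hon, hoff⟩ := hrun hP
    rw [hr.1 hP]
    have hq : ∀ s, t ≤ s → s ≤ k → g.q p t k s = x s := fun s h1 h2 =>
      ((hc s (Finset.mem_Icc.2 ⟨h1, h2⟩)).1 hP).1
    have hphi : ∀ s, t ≤ s → s ≤ k → g.phi p t k s = f s := fun s h1 h2 =>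
      ((hc s (Finset.mem_Icc.2 ⟨h1, h2⟩)).1 hP).2
    have hmem : ∀ s, t ≤ s → s ≤ k → s ∈ Finset.Icc 1 g.T := fun s h1 h2 =>
      Finset.mem_Icc.2 ⟨by omega, by omega⟩
    refine ⟨?_, ?_, ?_, ?_, ?_, ?_⟩
    · intro s hs
      obtain ⟨h1, h2⟩ := Finset.mem_Icc.1 hs
      rw [hq s h1 h2, mul_one]
      exact (ho.cap s (hmem s h1 h2) (hon s h1 h2)).1
    · intro s hs
      obtain ⟨h1, h2⟩ := Finset.mem_Icc.1 hs
      rw [hq s h1 h2, mul_one]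
      exact (ho.cap s (hmem s h1 h2) (hon s h1 h2)).2
    · intro h
      rw [hq k htk le_rfl, mul_one]
      exact ho.shut k (Finset.mem_Ico.2 ⟨by omega, h⟩) (hon k htk le_rfl) (hoff h)
    · intro s hs
      obtain ⟨h1, h2⟩ := Finset.mem_Icc.1 hs
      rw [hq s (by omega) h2, hq (s - 1) (by omega) (by omega), mul_one]
      exact (ho.ramp s (Finset.mem_Icc.2 ⟨by omega, by omega⟩) (hon _ (by omega) (by omega))
        (hon _ (by omega) h2)).1
    · intro s hs
      obtain ⟨h1, h2⟩ := Finset.mem_Icc.1 hs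
      rw [hq s (by omega) h2, hq (s - 1) (by omega) (by omega), mul_one]
      exact (ho.ramp s (Finset.mem_Icc.2 ⟨by omega, by omega⟩) (hon _ (by omega) (by omega))
        (hon _ (by omega) h2)).2
    · intro s hs j
      obtain ⟨h1, h2⟩ := Finset.mem_Icc.1 hs
      rw [hq s h1 h2, hphi s h1 h2, mul_one]
      linarith [ho.cost s (hmem s h1 h2) (hon s h1 h2) j]
  · rw [hr.2 hP]
    have hq : ∀ s, t ≤ s → s ≤ k → g.q p t k s = 0 := fun s h1 h2 =>
      ((hc s (Finset.mem_Icc.2 ⟨h1, h2⟩)).2 hP).1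
    have hphi : ∀ s, t ≤ s → s ≤ k → 0 ≤ g.phi p t k s := fun s h1 h2 =>
      ((hc s (Finset.mem_Icc.2 ⟨h1, h2⟩)).2 hP).2
    refine ⟨?_, ?_, ?_, ?_, ?_, ?_⟩
    · intro s hs
      obtain ⟨h1, h2⟩ := Finset.mem_Icc.1 hs
      rw [hq s h1 h2, mul_zero]
    · intro s hs
      obtain ⟨h1, h2⟩ := Finset.mem_Icc.1 hs
      rw [hq s h1 h2, mul_zero]
    · intro h
      rw [hq k htk le_rfl, mul_zero]
    · intro s hs
      obtain ⟨h1, h2⟩ := Finset.mem_Icc.1 hs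
      rw [hq s (by omega) h2, hq (s - 1) (by omega) (by omega), mul_zero, sub_zero]
    · intro s hs
      obtain ⟨h1, h2⟩ := Finset.mem_Icc.1 hs
      rw [hq s (by omega) h2, hq (s - 1) (by omega) (by omega), mul_zero, sub_zero]
    · intro s hs j
      obtain ⟨h1, h2⟩ := Finset.mem_Icc.1 hs
      rw [hq s h1 h2, mul_zero, mul_zero, sub_zero]
      exact hphi s h1 h2

theorem Encodes.feasible (hg : g.Valid) (hc : g.Commitment u) (ho : g.Operation u x f)
    (he : g.Encodes p u x f) : g.Feasible p := by
  have hf := he.isFlow hg hc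
  refine ⟨hf.first, hf.balance_down, hf.balance_up, ?_, ?_, ?_, hf.w_nonneg, hf.y_nonneg,
    hf.z_nonneg, hf.theta_nonneg⟩
  · rintro ⟨t, k⟩ hi
    obtain ⟨rfl, hk, hm⟩ := mem_TK1.1 hi
    exact ho.dispatch (he.first _ hi) (he.w_eq k hm) le_rfl hk (mem_Kbar.1 hm).2.2
      fun hr => ⟨fun s _ h => hr.2.1 s h, hr.2.2⟩
  · rintro ⟨t, k⟩ hi
    have hb := hg.on_bounds hi
    exact ho.dispatch (he.later _ hi) (he.y_eq _ hi) (by omega) hb.2.1 hb.2.2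
      fun hr => hr.2.2.2.2
  · rintro ⟨t, k⟩ hi
    have hb := hg.on_bounds hi
    have hcar := he.later _ hi t (Finset.mem_Icc.2 ⟨le_rfl, hb.2.1⟩)
    by_cases hr : g.OnRun u t k
    · rw [(he.y_eq _ hi).1 hr, (hcar.1 hr).1, mul_one]
      exact ho.start t (Finset.mem_Icc.2 ⟨by omega, by omega⟩) hr.2.2.2.1
        (hr.2.2.2.2.1 t le_rfl hb.2.1)
    · rw [(he.y_eq _ hi).2 hr, (hcar.2 hr).1, mul_zero]

theorem Encodes.isBinary (he : g.Encodes p u x f) : g.IsBinary p :=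
  ⟨fun k hk => (he.w_eq k hk).binary, fun i hi => (he.y_eq i hi).binary,
    fun i hi => (he.z_eq i hi).binary⟩

/-! ### Binary points of the polyhedron describe feasible schedules -/

theorem mem_of_w_ne {k : ℕ} (h : g.w p k ≠ 0) : k ∈ g.Kbar := by
  by_contra hk
  exact h (w_of_notMem p hk)
theorem mem_of_y_ne {t k : ℕ} (h : g.y p t k ≠ 0) : (t, k) ∈ g.TK2 := by
  by_contra hk
  exact h (y_of_notMem p hk)
theorem mem_of_z_ne {k t : ℕ} (h : g.z p k t ≠ 0) : (k, t) ∈ g.KT := by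
  by_contra hk
  exact h (z_of_notMem p hk)
theorem mem_of_theta_ne {k : ℕ} (h : g.theta p k ≠ 0) : k ∈ g.ThetaIdx := by
  by_contra hk
  exact h (theta_of_notMem p hk)

theorem mem_Kbar_of_w {k : ℕ} (h : g.w p k = 1) : k ∈ g.Kbar :=
  mem_of_w_ne (p := p) (by rw [h]; exact one_ne_zero)
theorem mem_TK2_of_y {t k : ℕ} (h : g.y p t k = 1) : (t, k) ∈ g.TK2 :=
  mem_of_y_ne (p := p) (by rw [h]; exact one_ne_zero)
theorem mem_KT_of_z {k t : ℕ} (h : g.z p k t = 1) : (k, t) ∈ g.KT :=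
  mem_of_z_ne (p := p) (by rw [h]; exact one_ne_zero)
theorem mem_ThetaIdx_of_theta {k : ℕ} (h : g.theta p k = 1) : k ∈ g.ThetaIdx :=
  mem_of_theta_ne (p := p) (by rw [h]; exact one_ne_zero)

/-- The period `s` is in an on-interval that is used by the point. -/
def OnAt (p : g.Space) (s : ℕ) : Prop :=
  s = 0 ∨ (∃ k, g.w p k = 1 ∧ s ≤ k) ∨ ∃ t k, g.y p t k = 1 ∧ t ≤ s ∧ s ≤ k

theorem le_sum_filter {α : Type} {A : Finset α} {r : α → ℝ} (h : ∀ i ∈ A, 0 ≤ r i)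
    {c : α → Prop} [DecidablePred c] {i : α} (hi : i ∈ A) (hc : c i) :
    r i ≤ ∑ j ∈ A with c j, r j :=
  Finset.single_le_sum (fun j hj => h j (Finset.mem_filter.1 hj).1)
    (Finset.mem_filter.2 ⟨hi, hc⟩)

section

variable (hg : g.Valid) (h : g.IsFlow p) (hb : g.IsBinary p)
include hg h

theorem IsFlow.theta_le_one {k : ℕ} : g.theta p k ≤ 1 := by
  by_cases hk : k ∈ g.ThetaIdx
  · rw [← edge_theta p hk]; exact h.edge_le_one hg _
  · rw [theta_of_notMem p hk]; exact zero_le_one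

/-- Two saturated edges covering the same period coincide, but an off-interval and an on-interval
are edges of different kinds. -/
theorem IsFlow.not_onAt_of_z {k t s : ℕ} (hz : g.z p k t = 1) (hks : k < s) (hst : s < t) :
    ¬ OnAt p s := by
  have hm := mem_KT_of_z hz
  have hbd := hg.off_bounds hm
  have he := (edge_z p hm).trans hz
  rintro (rfl | ⟨k', hw, hsk⟩ | ⟨t', k', hy, hts, hsk⟩)
  · omega
  · have := h.edge_unique hg (by omega : s ≤ g.T)
      he ((edge_w p (mem_Kbar_of_w hw)).trans hw) ⟨hks, hst⟩ hsk
    cases this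
  · have := h.edge_unique hg (by omega : s ≤ g.T)
      he ((edge_y p (mem_TK2_of_y hy)).trans hy) ⟨hks, hst⟩ ⟨hts, hsk⟩
    cases this

theorem IsFlow.not_onAt_of_theta {k s : ℕ} (hθ : g.theta p k = 1) (hks : k < s) (hsT : s ≤ g.T) :
    ¬ OnAt p s := by
  have he := (edge_theta p (mem_ThetaIdx_of_theta hθ)).trans hθ
  rintro (rfl | ⟨k', hw, hsk⟩ | ⟨t', k', hy, hts, hsk⟩)
  · omega
  · have := h.edge_unique hg hsT
      he ((edge_w p (mem_Kbar_of_w hw)).trans hw) hks hsk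
    cases this
  · have := h.edge_unique hg hsT
      he ((edge_y p (mem_TK2_of_y hy)).trans hy) hks ⟨hts, hsk⟩
    cases this

theorem IsFlow.w_unique {k k' : ℕ} (hw : g.w p k = 1) (hw' : g.w p k' = 1) : k = k' := by
  have := h.edge_unique hg (Nat.zero_le g.T)
      ((edge_w p (mem_Kbar_of_w hw)).trans hw) ((edge_w p (mem_Kbar_of_w hw')).trans hw') (Nat.zero_le k) (Nat.zero_le k')
  cases this
  rfl

theorem IsFlow.w_y_disjoint {k t k' s : ℕ} (hw : g.w p k = 1) (hy : g.y p t k' = 1) (hsk : s ≤ k)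
    (hts : t ≤ s) (hsk' : s ≤ k') : False := by
  have := (mem_Kbar.1 (mem_Kbar_of_w hw)).2.2
  have := h.edge_unique hg (by omega : s ≤ g.T)
      ((edge_w p (mem_Kbar_of_w hw)).trans hw) ((edge_y p (mem_TK2_of_y hy)).trans hy) hsk ⟨hts, hsk'⟩
  cases this

theorem IsFlow.y_unique {t k t' k' s : ℕ} (hy : g.y p t k = 1) (hy' : g.y p t' k' = 1)
    (hts : t ≤ s) (hsk : s ≤ k) (hts' : t' ≤ s) (hsk' : s ≤ k') : (t, k) = (t', k') := by
  have := hg.on_bounds (mem_TK2_of_y hy)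
  have := h.edge_unique hg (by omega : s ≤ g.T)
      ((edge_y p (mem_TK2_of_y hy)).trans hy) ((edge_y p (mem_TK2_of_y hy')).trans hy') ⟨hts, hsk⟩ ⟨hts', hsk'⟩
  cases this
  rfl

include hb

omit hg in
theorem IsFlow.exists_w : ∃ k, g.w p k = 1 := by
  obtain ⟨k, hk, hne⟩ := Finset.exists_ne_zero_of_sum_ne_zero
    (by rw [h.first]; exact one_ne_zero : ∑ k ∈ g.Kbar, g.w p k ≠ 0)
  exact ⟨k, (hb.1 k hk).resolve_left hne⟩

/-- The inflow is at least one, hence so is the outflow. `θ` is not assumed binary: without flow on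
any `z`, it is at least one by conservation and at most one as an edge. -/
theorem IsFlow.exists_out {k : ℕ} (hk : k < g.T) (hin : g.w p k = 1 ∨ ∃ t, g.y p t k = 1) :
    (∃ t, g.z p k t = 1) ∨ g.theta p k = 1 := by
  have hbal := h.balance_down' hg hk
  have hw : 0 ≤ g.w p k := by
    by_cases hm : k ∈ g.Kbar
    exacts [h.w_nonneg _ hm, (w_of_notMem p hm).ge]
  have hy : 0 ≤ ∑ i ∈ g.TK2 with i.2 = k, g.y p i.1 i.2 :=
    Finset.sum_nonneg fun i hi => h.y_nonneg i (Finset.mem_filter.1 hi).1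
  have h1 : 1 ≤ g.w p k + ∑ i ∈ g.TK2 with i.2 = k, g.y p i.1 i.2 := by
    rcases hin with hin | ⟨t, ht⟩
    · linarith
    · have := le_sum_filter (c := fun i => i.2 = k) h.y_nonneg (mem_TK2_of_y ht) rfl
      dsimp only at this
      linarith
  by_cases hz : ∑ i ∈ g.KT with i.1 = k, g.z p i.1 i.2 = 0
  · right
    have := h.theta_le_one hg (k := k)
    linarith
  · left
    obtain ⟨⟨k', t⟩, hm, hne⟩ := Finset.exists_ne_zero_of_sum_ne_zero hz
    obtain ⟨hm', rfl⟩ := Finset.mem_filter.1 hm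
    exact ⟨t, (hb.2.2 _ hm').resolve_left hne⟩

theorem IsFlow.exists_in {k : ℕ} (hk : k < g.T) (hout : (∃ t, g.z p k t = 1) ∨ g.theta p k = 1) :
    g.w p k = 1 ∨ ∃ t, g.y p t k = 1 := by
  have hbal := h.balance_down' hg hk
  have hθ : 0 ≤ g.theta p k := by
    by_cases hm : k ∈ g.ThetaIdx
    exacts [h.theta_nonneg _ hm, (theta_of_notMem p hm).ge]
  have hz : 0 ≤ ∑ i ∈ g.KT with i.1 = k, g.z p i.1 i.2 :=
    Finset.sum_nonneg fun i hi => h.z_nonneg i (Finset.mem_filter.1 hi).1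
  have h1 : 1 ≤ ∑ i ∈ g.KT with i.1 = k, g.z p i.1 i.2 + g.theta p k := by
    rcases hout with ⟨t, ht⟩ | hout
    · have := le_sum_filter (c := fun i => i.1 = k) h.z_nonneg (mem_KT_of_z ht) rfl
      dsimp only at this
      linarith
    · linarith
  by_cases hy : ∑ i ∈ g.TK2 with i.2 = k, g.y p i.1 i.2 = 0
  · left
    have hne : g.w p k ≠ 0 := fun h0 => by linarith
    exact (hb.1 k (mem_of_w_ne hne)).resolve_left hne
  · right
    obtain ⟨⟨t, k'⟩, hm, hne⟩ := Finset.exists_ne_zero_of_sum_ne_zero hy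
    obtain ⟨hm', rfl⟩ := Finset.mem_filter.1 hm
    exact ⟨t, (hb.2.1 _ hm').resolve_left hne⟩

theorem IsFlow.exists_z_of_y {t k : ℕ} (hy : g.y p t k = 1) : ∃ k', g.z p k' t = 1 := by
  have h1 := le_sum_filter (c := fun i => i.1 = t) h.y_nonneg (mem_TK2_of_y hy) rfl
  dsimp only at h1
  rw [h.balance_up' hg, hy] at h1
  obtain ⟨⟨k', t'⟩, hm, hne⟩ := Finset.exists_ne_zero_of_sum_ne_zero (zero_lt_one.trans_le h1).ne'
  obtain ⟨hm', rfl⟩ := Finset.mem_filter.1 hm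
  exact ⟨k', (hb.2.2 _ hm').resolve_left hne⟩

theorem IsFlow.exists_y_of_z {k t : ℕ} (hz : g.z p k t = 1) : ∃ k', g.y p t k' = 1 := by
  have h1 := le_sum_filter (c := fun i => i.2 = t) h.z_nonneg (mem_KT_of_z hz) rfl
  dsimp only at h1
  rw [← h.balance_up' hg, hz] at h1
  obtain ⟨⟨t', k'⟩, hm, hne⟩ := Finset.exists_ne_zero_of_sum_ne_zero (zero_lt_one.trans_le h1).ne'
  obtain ⟨hm', rfl⟩ := Finset.mem_filter.1 hm
  exact ⟨k', (hb.2.1 _ hm').resolve_left hne⟩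

theorem IsFlow.not_onAt_succ {k : ℕ} (hk : k < g.T) (hin : g.w p k = 1 ∨ ∃ t, g.y p t k = 1) :
    ¬ OnAt p (k + 1) := by
  rcases h.exists_out hg hb hk hin with ⟨t, hz⟩ | hθ
  · have := hg.off_bounds (mem_KT_of_z hz)
    exact h.not_onAt_of_z hg hz (by omega) (by omega)
  · exact h.not_onAt_of_theta hg hθ (by omega) hk

theorem IsFlow.onAt_of_out {k : ℕ} (hk : k < g.T)
    (hout : (∃ t, g.z p k t = 1) ∨ g.theta p k = 1) : OnAt p k := by
  rcases h.exists_in hg hb hk hout with hw | ⟨t, hy⟩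
  · exact .inr (.inl ⟨k, hw, le_rfl⟩)
  · exact .inr (.inr ⟨t, k, hy, (hg.on_bounds (mem_TK2_of_y hy)).2.1, le_rfl⟩)

theorem IsFlow.initialRun_of_w {k : ℕ} (hw : g.w p k = 1) : g.InitialRun (OnAt p) k :=
  ⟨(mem_Kbar.1 (mem_Kbar_of_w hw)).2.2, fun _ hs => .inr (.inl ⟨k, hw, hs⟩),
    fun hk => h.not_onAt_succ hg hb hk (.inl hw)⟩

theorem IsFlow.onRun_of_y {t k : ℕ} (hy : g.y p t k = 1) : g.OnRun (OnAt p) t k := by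
  have hbd := hg.on_bounds (mem_TK2_of_y hy)
  obtain ⟨k', hz⟩ := h.exists_z_of_y hg hb hy
  have := hg.off_bounds (mem_KT_of_z hz)
  exact ⟨by omega, hbd.2.1, hbd.2.2, h.not_onAt_of_z hg hz (by omega) (by omega),
    fun s h1 h2 => .inr (.inr ⟨t, k, hy, h1, h2⟩),
    fun hk => h.not_onAt_succ hg hb hk (.inr ⟨t, hy⟩)⟩

theorem IsFlow.offRun_of_z {k t : ℕ} (hz : g.z p k t = 1) : g.OffRun (OnAt p) k t := by
  have hbd := hg.off_bounds (mem_KT_of_z hz)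
  obtain ⟨k', hy⟩ := h.exists_y_of_z hg hb hz
  exact ⟨by omega, hbd.2.2, h.onAt_of_out hg hb (by omega) (.inl ⟨t, hz⟩),
    fun s h1 h2 => h.not_onAt_of_z hg hz h1 h2,
    .inr (.inr ⟨t, k', hy, le_rfl, (hg.on_bounds (mem_TK2_of_y hy)).2.1⟩)⟩

theorem IsFlow.finalOff_of_theta {k : ℕ} (hθ : g.theta p k = 1) : g.FinalOff (OnAt p) k := by
  have hbd := mem_ThetaIdx.1 (mem_ThetaIdx_of_theta hθ)
  exact ⟨hbd.2, h.onAt_of_out hg hb hbd.2 (.inr hθ), fun s h1 h2 => h.not_onAt_of_theta hg hθ h1 h2⟩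

theorem IsFlow.w_of_initialRun {k : ℕ} (hr : g.InitialRun (OnAt p) k) : g.w p k = 1 := by
  obtain ⟨k₀, hw⟩ := h.exists_w hb
  rwa [hr.unique (h.initialRun_of_w hg hb hw)]

/-- A used on-interval contains `t`. It must begin at `t`, since otherwise it would also make `t -
1` on; its end is then determined by the run. -/
theorem IsFlow.y_of_onRun {t k : ℕ} (hr : g.OnRun (OnAt p) t k) : g.y p t k = 1 := by
  obtain ⟨h1, h2, h3, h4, h5, h6⟩ := id hr
  rcases h5 t le_rfl h2 with rfl | ⟨k', hw, hk'⟩ | ⟨t', k', hy, ht', hk'⟩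
  · omega
  · exact absurd (.inr (.inl ⟨k', hw, by omega⟩)) h4
  · rcases ht'.eq_or_lt with rfl | hlt
    · rwa [hr.end_unique (h.onRun_of_y hg hb hy)]
    · exact absurd (.inr (.inr ⟨t', k', hy, by omega, by omega⟩)) h4

omit hg in
theorem IsFlow.in_of_onAt {k : ℕ} (hon : OnAt p k) (hoff : ¬ OnAt p (k + 1)) :
    g.w p k = 1 ∨ ∃ t, g.y p t k = 1 := by
  rcases hon with rfl | ⟨k', hw, hk'⟩ | ⟨t', k', hy, ht', hk'⟩
  -- Period `0` is on by convention. If the used `w k₀` had `k₀ > 0`, period `1` would be on too.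
  · obtain ⟨k₀, hw⟩ := h.exists_w hb
    rcases Nat.eq_zero_or_pos k₀ with rfl | hpos
    · exact .inl hw
    · exact absurd (.inr (.inl ⟨k₀, hw, hpos⟩)) hoff
  · rcases hk'.eq_or_lt with rfl | hlt
    · exact .inl hw
    · exact absurd (.inr (.inl ⟨k', hw, hlt⟩)) hoff
  · rcases hk'.eq_or_lt with rfl | hlt
    · exact .inr ⟨t', hy⟩
    · exact absurd (.inr (.inr ⟨t', k', hy, by omega, hlt⟩)) hoff

theorem IsFlow.z_of_offRun {k t : ℕ} (hr : g.OffRun (OnAt p) k t) : g.z p k t = 1 := by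
  obtain ⟨h1, h2, h3, h4, h5⟩ := id hr
  rcases h.exists_out hg hb (by omega) (h.in_of_onAt hb h3 (h4 (k + 1) (by omega) h1))
    with ⟨t', hz⟩ | hθ
  · rwa [hr.end_unique (h.offRun_of_z hg hb hz)]
  · exact absurd (h.finalOff_of_theta hg hb hθ) hr.not_finalOff

theorem IsFlow.theta_of_finalOff {k : ℕ} (hr : g.FinalOff (OnAt p) k) : g.theta p k = 1 := by
  obtain ⟨h1, h2, h3⟩ := id hr
  rcases h.exists_out hg hb h1 (h.in_of_onAt hb h2 (h3 (k + 1) (by omega) h1)) with ⟨t', hz⟩ | hθ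
  · exact absurd hr (h.offRun_of_z hg hb hz).not_finalOff
  · exact hθ

/-- The flow of the edge `θ k` of a binary point is binary. -/
theorem IsFlow.theta_binary {k : ℕ} (hk : k < g.T) : g.theta p k = 0 ∨ g.theta p k = 1 := by
  by_cases hne : g.theta p k = 0
  · exact .inl hne
  right
  have hkm := mem_of_theta_ne hne
  have hpos := lt_of_le_of_ne (h.theta_nonneg k hkm) (Ne.symm hne)
  have hbal := h.balance_down' hg hk
  have hz : 0 ≤ ∑ i ∈ g.KT with i.1 = k, g.z p i.1 i.2 :=
    Finset.sum_nonneg fun i hi => h.z_nonneg i (Finset.mem_filter.1 hi).1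
  have hin : g.w p k = 1 ∨ ∃ t, g.y p t k = 1 := by
    by_cases hy : ∑ i ∈ g.TK2 with i.2 = k, g.y p i.1 i.2 = 0
    · left
      have hne : g.w p k ≠ 0 := fun h0 => by linarith
      exact (hb.1 k (mem_of_w_ne hne)).resolve_left hne
    · right
      obtain ⟨⟨t, k'⟩, hm, hyne⟩ := Finset.exists_ne_zero_of_sum_ne_zero hy
      obtain ⟨hm', rfl⟩ := Finset.mem_filter.1 hm
      exact ⟨t, (hb.2.1 _ hm').resolve_left hyne⟩
  rcases h.exists_out hg hb hk hin with ⟨t, hz1⟩ | hθ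
  · have hm := mem_KT_of_z hz1
    have := hg.off_bounds hm
    -- The saturated off-interval and `θ k` both cover `k + 1`, which leaves no room for positive `θ
    -- k`.
    have := h.edge_add_le_one hg (s := k + 1) (by omega)
      (e := .inr (.inr (.inl ⟨(k, t), hm⟩))) (e' := .inr (.inr (.inr ⟨k, hkm⟩)))
      (by simp only [Covers]; omega) (by simp only [Covers]; omega) (by simp)
    rw [edge_z, edge_theta, hz1] at this
    linarith
  · exact hθ

theorem IsFlow.commitment : g.Commitment (OnAt p) where
  initially_on := .inl rfl
  first_up k hr := by
    have hm := mem_Kbar.1 (mem_Kbar_of_w (h.w_of_initialRun hg hb hr))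
    -- `Lmax - s0` is a truncated subtraction; this makes it exact.
    have := hg.s0_le_Lmax
    rw [t0] at hm
    omega
  later_up t k hr := (hg.mem_TK2.1 (mem_TK2_of_y (h.y_of_onRun hg hb hr))).2.2.2
  down k t hr := by
    have hm := mem_KT.1 (mem_KT_of_z (h.z_of_offRun hg hb hr))
    omega

end

/-- The value at `s` that a family of values on the on-intervals induces, weighted by the flow. -/
noncomputable def blend (p : g.Space) (V : ℕ → ℕ → ℕ → ℝ) (s : ℕ) : ℝ :=
  ∑ k ∈ g.Kbar, (if s ≤ k then g.w p k * V 1 k s else 0)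
    + ∑ i ∈ g.TK2, (if i.1 ≤ s ∧ s ≤ i.2 then g.y p i.1 i.2 * V i.1 i.2 s else 0)

/-! ### Generation amounts and costs read off a binary point -/

theorem Dispatch.q_eq_zero {t k s : ℕ} (h : g.Dispatch p t k 0) (hts : t ≤ s) (hsk : s ≤ k) :
    g.q p t k s = 0 := by
  have h1 := h.cap_lower s (Finset.mem_Icc.2 ⟨hts, hsk⟩)
  have h2 := h.cap_upper s (Finset.mem_Icc.2 ⟨hts, hsk⟩)
  rw [mul_zero] at h1 h2
  exact le_antisymm h2 h1

/-- With no flow and hence no generation, any single cost piece reads `0 ≤ φ`; this is where `N ≥ 1`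
enters. -/
theorem Dispatch.phi_nonneg (hg : g.Valid) {t k s : ℕ} (h : g.Dispatch p t k 0) (hts : t ≤ s)
    (hsk : s ≤ k) : 0 ≤ g.phi p t k s := by
  have h1 := h.cost s (Finset.mem_Icc.2 ⟨hts, hsk⟩) ⟨0, hg.N_pos⟩
  rwa [mul_zero, h.q_eq_zero hts hsk, mul_zero, sub_zero] at h1

/-- Used on-intervals are disjoint, so the sum has a single nonzero weight at `s`. -/
theorem IsFlow.blend_of_w (hg : g.Valid) (h : g.IsFlow p) (hb : g.IsBinary p) {k s : ℕ}
    (hw : g.w p k = 1) (hsk : s ≤ k) (V : ℕ → ℕ → ℕ → ℝ) : blend p V s = V 1 k s := by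
  unfold blend
  rw [Finset.sum_eq_single_of_mem k (mem_Kbar_of_w hw), Finset.sum_eq_zero, if_pos hsk, hw, one_mul,
    add_zero]
  · rintro ⟨t', k'⟩ hi
    split_ifs with hs
    · rcases hb.2.1 _ hi with hy | hy
      · rw [hy, zero_mul]
      · exact (h.w_y_disjoint hg hw hy hsk hs.1 hs.2).elim
    · rfl
  · intro k' hk' hne
    split_ifs with hs
    · rcases hb.1 k' hk' with hw' | hw'
      · rw [hw', zero_mul]
      · exact absurd (h.w_unique hg hw' hw) hne
    · rfl

theorem IsFlow.blend_of_y (hg : g.Valid) (h : g.IsFlow p) (hb : g.IsBinary p) {t k s : ℕ}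
    (hy : g.y p t k = 1) (hts : t ≤ s) (hsk : s ≤ k) (V : ℕ → ℕ → ℕ → ℝ) :
    blend p V s = V t k s := by
  unfold blend
  rw [Finset.sum_eq_single_of_mem (t, k) (mem_TK2_of_y hy), Finset.sum_eq_zero, if_pos ⟨hts, hsk⟩,
    hy, one_mul, zero_add]
  · intro k' hk'
    split_ifs with hs
    · rcases hb.1 k' hk' with hw | hw
      · rw [hw, zero_mul]
      · exact (h.w_y_disjoint hg hw hy hs hts hsk).elim
    · rfl
  · rintro ⟨t', k'⟩ hi hne
    split_ifs with hs
    · rcases hb.2.1 _ hi with hy' | hy'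
      · rw [hy', zero_mul]
      · exact absurd (h.y_unique hg hy' hy hs.1 hs.2 hts hsk) hne
    · rfl

theorem IsBinary.blend_of_off (hb : g.IsBinary p) {s : ℕ} (hs : ¬ OnAt p s)
    (V : ℕ → ℕ → ℕ → ℝ) : blend p V s = 0 := by
  unfold blend
  rw [Finset.sum_eq_zero, Finset.sum_eq_zero, add_zero]
  · rintro ⟨t, k⟩ hi
    split_ifs with hc
    · rcases hb.2.1 _ hi with hy | hy
      · rw [hy, zero_mul]
      · exact absurd (.inr (.inr ⟨t, k, hy, hc⟩)) hs
    · rfl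
  · intro k hk
    split_ifs with hc
    · rcases hb.1 k hk with hw | hw
      · rw [hw, zero_mul]
      · exact absurd (.inr (.inl ⟨k, hw, hc⟩)) hs
    · rfl

/-- Gathers all that the operating restrictions at an on-period need: the used interval around it,
with its unscaled dispatch constraints and its behaviour at both ends. An interval beginning at
period `1` is a continuation, so the start-up limit is tied to `t - 1` being off. -/
theorem Feasible.exists_interval (hg : g.Valid) (hf : g.Feasible p) (hb : g.IsBinary p) {s : ℕ}
    (hs : 1 ≤ s) (hon : OnAt p s) :
    ∃ t k, 1 ≤ t ∧ t ≤ s ∧ s ≤ k ∧ k ≤ g.T ∧ g.Dispatch p t k 1 ∧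
      (∀ r, t ≤ r → r ≤ k → OnAt p r ∧ ∀ V, blend p V r = V t k r) ∧
      (k < g.T → ¬ OnAt p (k + 1)) ∧ (t = 1 ∨ ¬ OnAt p (t - 1)) ∧
      (¬ OnAt p (t - 1) → g.q p t k t ≤ g.VuStart t) := by
  have h := hf.isFlow
  rcases hon with rfl | ⟨k, hw, hsk⟩ | ⟨t, k, hy, hts, hsk⟩
  · omega
  · have hr := h.initialRun_of_w hg hb hw
    have hd := hf.dispatch_first (1, k) (mem_TK1.2 ⟨rfl, by omega, mem_Kbar_of_w hw⟩)
    dsimp only at hd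
    rw [hw] at hd
    exact ⟨1, k, le_rfl, hs, hsk, hr.1, hd,
      fun r _ h2 => ⟨hr.2.1 r h2, h.blend_of_w hg hb hw h2⟩, hr.2.2, .inl rfl,
      fun hn => absurd (.inl rfl) hn⟩
  · have hr := h.onRun_of_y hg hb hy
    have hm := mem_TK2_of_y hy
    have hd := hf.dispatch_later _ hm
    have hst := hf.start _ hm
    dsimp only at hd hst
    rw [hy] at hd hst
    rw [mul_one] at hst
    exact ⟨t, k, hr.1, hts, hsk, hr.2.2.1, hd,
      fun r h1 h2 => ⟨hr.2.2.2.2.1 r h1 h2, h.blend_of_y hg hb hy h1 h2⟩, hr.2.2.2.2.2,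
      .inr hr.2.2.2.1, fun _ => hst⟩

theorem Feasible.operation (hg : g.Valid) (hf : g.Feasible p) (hb : g.IsBinary p) :
    g.Operation (OnAt p) (blend p (g.q p)) (blend p (g.phi p)) where
  off s _ hoff := ⟨hb.blend_of_off hoff _, hb.blend_of_off hoff _⟩
  cap s hs hon := by
    obtain ⟨t, k, h1, hts, hsk, hkT, hd, hV, -⟩ :=
      hf.exists_interval hg hb (Finset.mem_Icc.1 hs).1 hon
    have hl := hd.cap_lower s (Finset.mem_Icc.2 ⟨hts, hsk⟩)
    have hu := hd.cap_upper s (Finset.mem_Icc.2 ⟨hts, hsk⟩)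
    rw [mul_one] at hl hu
    rw [(hV s hts hsk).2]
    exact ⟨hl, hu⟩
  start s hs hoff hon := by
    obtain ⟨t, k, h1, hts, hsk, hkT, hd, hV, -, -, hst⟩ :=
      hf.exists_interval hg hb (Finset.mem_Icc.1 hs).1 hon
    rcases hts.eq_or_lt with rfl | hlt
    · rw [(hV t le_rfl hsk).2]
      exact hst hoff
    · exact absurd (hV (s - 1) (by omega) (by omega)).1 hoff
  shut s hs hon hoff := by
    obtain ⟨t, k, h1, hts, hsk, hkT, hd, hV, -⟩ :=
      hf.exists_interval hg hb (Finset.mem_Ico.1 hs).1 hon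
    rcases hsk.eq_or_lt with rfl | hlt
    · have := hd.shut (Finset.mem_Ico.1 hs).2
      rw [mul_one] at this
      rwa [(hV s hts le_rfl).2]
    · exact absurd (hV (s + 1) (by omega) hlt).1 hoff
  ramp s hs hon' hon := by
    have hs2 := (Finset.mem_Icc.1 hs).1
    obtain ⟨t, k, h1, hts, hsk, hkT, hd, hV, -, hstart, -⟩ :=
      hf.exists_interval hg hb (by omega) hon
    -- Consecutive on-periods lie in one interval: `s` cannot be its first period, since `s ≥ 2` and
    -- `s - 1` is on.
    rcases hts.eq_or_lt with rfl | hlt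
    · rcases hstart with rfl | hstart
      · omega
      · exact absurd hon' hstart
    · have hdn := hd.ramp_down s (Finset.mem_Icc.2 ⟨hlt, hsk⟩)
      have hup := hd.ramp_up s (Finset.mem_Icc.2 ⟨hlt, hsk⟩)
      rw [mul_one] at hdn hup
      rw [(hV s hts hsk).2, (hV (s - 1) (by omega) (by omega)).2]
      exact ⟨hdn, hup⟩
  cost s hs hon j := by
    obtain ⟨t, k, h1, hts, hsk, hkT, hd, hV, -⟩ :=
      hf.exists_interval hg hb (Finset.mem_Icc.1 hs).1 hon
    have := hd.cost s (Finset.mem_Icc.2 ⟨hts, hsk⟩) j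
    rw [mul_one] at this
    rw [(hV s hts hsk).2, (hV s hts hsk).2]
    linarith

theorem isIndicator_of_iff {P : Prop} {r : ℝ} (h : P ↔ r = 1) (hb : r = 0 ∨ r = 1) :
    IsIndicator P r :=
  ⟨h.1, fun hP => hb.resolve_right fun hr => hP (h.2 hr)⟩

theorem Feasible.encodes (hg : g.Valid) (hf : g.Feasible p) (hb : g.IsBinary p) :
    g.Encodes p (OnAt p) (blend p (g.q p)) (blend p (g.phi p)) := by
  have h := hf.isFlow
  have hw : ∀ k ∈ g.Kbar, IsIndicator (g.InitialRun (OnAt p) k) (g.w p k) := fun k hk =>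
    isIndicator_of_iff ⟨h.w_of_initialRun hg hb, h.initialRun_of_w hg hb⟩ (hb.1 k hk)
  have hy : ∀ i ∈ g.TK2, IsIndicator (g.OnRun (OnAt p) i.1 i.2) (g.y p i.1 i.2) := fun i hi =>
    isIndicator_of_iff ⟨h.y_of_onRun hg hb, h.onRun_of_y hg hb⟩ (hb.2.1 i hi)
  refine ⟨hw, hy, ?_, ?_, ?_, ?_⟩
  · exact fun i hi =>
      isIndicator_of_iff ⟨h.z_of_offRun hg hb, h.offRun_of_z hg hb⟩ (hb.2.2 i hi)
  · exact fun k hk => isIndicator_of_iff ⟨h.theta_of_finalOff hg hb, h.finalOff_of_theta hg hb⟩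
      (h.theta_binary hg hb (mem_ThetaIdx.1 hk).2)
  · rintro ⟨t, k⟩ hi s hs
    obtain ⟨rfl, hk, hm⟩ := mem_TK1.1 hi
    obtain ⟨hs1, hsk⟩ := Finset.mem_Icc.1 hs
    refine ⟨fun hr => ?_, fun hr => ?_⟩
    · have hw1 := (hw k hm).1 hr
      exact ⟨(h.blend_of_w hg hb hw1 hsk _).symm, (h.blend_of_w hg hb hw1 hsk _).symm⟩
    · have hd := hf.dispatch_first _ hi
      rw [(hw k hm).2 hr] at hd
      exact ⟨hd.q_eq_zero hs1 hsk, hd.phi_nonneg hg hs1 hsk⟩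
  · rintro ⟨t, k⟩ hi s hs
    obtain ⟨hts, hsk⟩ := Finset.mem_Icc.1 hs
    refine ⟨fun hr => ?_, fun hr => ?_⟩
    · have hy1 := (hy _ hi).1 hr
      exact ⟨(h.blend_of_y hg hb hy1 hts hsk _).symm, (h.blend_of_y hg hb hy1 hts hsk _).symm⟩
    · have hd := hf.dispatch_later _ hi
      rw [(hy _ hi).2 hr] at hd
      exact ⟨hd.q_eq_zero hts hsk, hd.phi_nonneg hg hts hsk⟩

/-- The points that describe a feasible schedule are the binary points of the polyhedron. -/
theorem Valid.uc_eq (hg : g.Valid) : g.UC = {p | p ∈ g.D4 ∧ g.IsBinary p} := by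
  ext p
  constructor
  · rintro ⟨u, x, f, hc, ho, he⟩
    exact ⟨he.feasible hg hc ho, he.isBinary⟩
  · rintro ⟨hf, hb⟩
    exact ⟨_, _, _, hf.isFlow.commitment hg hb, hf.operation hg hb, hf.encodes hg hb⟩

/-! ### The polyhedron is the convex hull of its binary points -/

/-- The dispatch constraints are homogeneous and linear jointly in the point and `r`, so their
solutions form a convex cone. -/
theorem Dispatch.comb {p p' : g.Space} {t k : ℕ} {r r' a b : ℝ} (h : g.Dispatch p t k r)
    (h' : g.Dispatch p' t k r') (ha : 0 ≤ a) (hb : 0 ≤ b) :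
    g.Dispatch (a • p + b • p') t k (a * r + b * r') := by
  refine ⟨?_, ?_, ?_, ?_, ?_, ?_⟩
  · intro s hs
    rw [q_add, q_smul, q_smul]
    linarith [mul_le_mul_of_nonneg_left (h.cap_lower s hs) ha,
      mul_le_mul_of_nonneg_left (h'.cap_lower s hs) hb]
  · intro s hs
    rw [q_add, q_smul, q_smul]
    linarith [mul_le_mul_of_nonneg_left (h.cap_upper s hs) ha,
      mul_le_mul_of_nonneg_left (h'.cap_upper s hs) hb]
  · intro hk
    rw [q_add, q_smul, q_smul]
    linarith [mul_le_mul_of_nonneg_left (h.shut hk) ha,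
      mul_le_mul_of_nonneg_left (h'.shut hk) hb]
  · intro s hs
    simp only [q_add, q_smul]
    linarith [mul_le_mul_of_nonneg_left (h.ramp_down s hs) ha,
      mul_le_mul_of_nonneg_left (h'.ramp_down s hs) hb]
  · intro s hs
    simp only [q_add, q_smul]
    linarith [mul_le_mul_of_nonneg_left (h.ramp_up s hs) ha,
      mul_le_mul_of_nonneg_left (h'.ramp_up s hs) hb]
  · intro s hs j
    simp only [q_add, q_smul, phi_add, phi_smul]
    linarith [mul_le_mul_of_nonneg_left (h.cost s hs j) ha,
      mul_le_mul_of_nonneg_left (h'.cost s hs j) hb]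

theorem convex_D4 (g : Generator) : Convex ℝ g.D4 := by
  intro p h p' h' a b ha hb hab
  refine ⟨?_, ?_, ?_, ?_, ?_, ?_, ?_, ?_, ?_, ?_⟩
  · simp only [w_add, w_smul, Finset.sum_add_distrib, ← Finset.mul_sum, h.first, h'.first]
    linarith
  · intro s hs
    simp only [w_add, w_smul, y_add, y_smul, z_add, z_smul, theta_add, theta_smul,
      Finset.sum_add_distrib, ← Finset.mul_sum]
    linear_combination a * h.balance_down s hs + b * h'.balance_down s hs
  · intro s hs
    simp only [y_add, y_smul, z_add, z_smul, Finset.sum_add_distrib, ← Finset.mul_sum]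
    linear_combination a * h.balance_up s hs + b * h'.balance_up s hs
  · intro i hi
    rw [w_add, w_smul, w_smul]
    exact (h.dispatch_first i hi).comb (h'.dispatch_first i hi) ha hb
  · intro i hi
    rw [y_add, y_smul, y_smul]
    exact (h.dispatch_later i hi).comb (h'.dispatch_later i hi) ha hb
  · intro i hi
    simp only [q_add, q_smul, y_add, y_smul]
    linarith [mul_le_mul_of_nonneg_left (h.start i hi) ha,
      mul_le_mul_of_nonneg_left (h'.start i hi) hb]
  · intro k hk
    rw [w_add, w_smul, w_smul]
    exact add_nonneg (mul_nonneg ha (h.w_nonneg k hk)) (mul_nonneg hb (h'.w_nonneg k hk))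
  · intro i hi
    rw [y_add, y_smul, y_smul]
    exact add_nonneg (mul_nonneg ha (h.y_nonneg i hi)) (mul_nonneg hb (h'.y_nonneg i hi))
  · intro i hi
    rw [z_add, z_smul, z_smul]
    exact add_nonneg (mul_nonneg ha (h.z_nonneg i hi)) (mul_nonneg hb (h'.z_nonneg i hi))
  · intro k hk
    rw [theta_add, theta_smul, theta_smul]
    exact add_nonneg (mul_nonneg ha (h.theta_nonneg k hk)) (mul_nonneg hb (h'.theta_nonneg k hk))

/-! ### Rescaling the generation to another flow -/

theorem mem_TK {t k : ℕ} : (t, k) ∈ g.TK ↔ (t, k) ∈ g.TK1 ∨ (t, k) ∈ g.TK2 := Finset.mem_union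

theorem mem_QIdx {t k s : ℕ} : (t, k, s) ∈ g.QIdx ↔ (t, k) ∈ g.TK ∧ t ≤ s ∧ s ≤ k := by
  simp only [QIdx, Finset.mem_biUnion, Finset.mem_image, Finset.mem_Icc]
  constructor
  · rintro ⟨⟨t', k'⟩, hi, s', hs, he⟩
    cases he
    exact ⟨hi, hs⟩
  · exact fun h => ⟨(t, k), h.1, s, h.2, rfl⟩

/-- The flow of the on-interval `[t, k]`. Later on-intervals never start at period `1`. -/
noncomputable def use (p : g.Space) (t k : ℕ) : ℝ := if t = 1 then g.w p k else g.y p t k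

theorem use_first (p : g.Space) {k : ℕ} : use p 1 k = g.w p k := if_pos rfl

theorem Valid.use_later (hg : g.Valid) (p : g.Space) {t k : ℕ} (h : (t, k) ∈ g.TK2) :
    use p t k = g.y p t k := if_neg (by have := hg.on_bounds h; omega)

theorem Feasible.dispatch (hg : g.Valid) (h : g.Feasible p) {t k : ℕ} (hi : (t, k) ∈ g.TK) :
    g.Dispatch p t k (use p t k) := by
  rcases mem_TK.1 hi with hi | hi
  · have := h.dispatch_first _ hi
    obtain ⟨rfl, -⟩ := mem_TK1.1 hi
    rwa [use_first]
  · rw [hg.use_later p hi]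
    exact h.dispatch_later _ hi

/-- The point with flow `F` whose generation amounts and costs are those of `p`, rescaled to `F`;
costs of unused on-intervals are kept. -/
noncomputable def rescale (p : g.Space) (F : g.Edge → ℝ) : g.Space :=
  (fun k => F (.inl k), fun i => F (.inr (.inl i)), fun i => F (.inr (.inr (.inl i))),
    fun k => F (.inr (.inr (.inr k))),
    fun i => g.q p i.1.1 i.1.2.1 i.1.2.2 / use p i.1.1 i.1.2.1 * use (ofEdge F) i.1.1 i.1.2.1,
    fun i => if use p i.1.1 i.1.2.1 = 0 then g.phi p i.1.1 i.1.2.1 i.1.2.2 else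
      g.phi p i.1.1 i.1.2.1 i.1.2.2 / use p i.1.1 i.1.2.1 * use (ofEdge F) i.1.1 i.1.2.1)

theorem q_rescale (p : g.Space) (F : g.Edge → ℝ) {t k s : ℕ} (hi : (t, k) ∈ g.TK) (hts : t ≤ s)
    (hsk : s ≤ k) :
    g.q (rescale p F) t k s = g.q p t k s / use p t k * use (ofEdge F) t k :=
  val_of_mem _ (mem_QIdx.2 ⟨hi, hts, hsk⟩)

theorem phi_rescale (p : g.Space) (F : g.Edge → ℝ) {t k s : ℕ} (hi : (t, k) ∈ g.TK) (hts : t ≤ s)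
    (hsk : s ≤ k) :
    g.phi (rescale p F) t k s = if use p t k = 0 then g.phi p t k s else
      g.phi p t k s / use p t k * use (ofEdge F) t k :=
  val_of_mem _ (mem_QIdx.2 ⟨hi, hts, hsk⟩)

theorem use_add_smul (F G : g.Edge → ℝ) (a b : ℝ) (t k : ℕ) :
    use (ofEdge (a • F + b • G)) t k = a * use (ofEdge F) t k + b * use (ofEdge G) t k := by
  have : (ofEdge (a • F + b • G) : g.Space) = a • ofEdge F + b • ofEdge G := by
    simp only [ofEdge]
    ext <;> simp
  rw [this]
  unfold use
  split_ifs
  · rw [w_add, w_smul, w_smul]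
  · rw [y_add, y_smul, y_smul]

/-- Only affine, not linear: the costs kept on unused intervals are constant in the flow, which is
where `a + b = 1` is needed. -/
theorem rescale_comb (p : g.Space) (F G : g.Edge → ℝ) {a b : ℝ} (hab : a + b = 1) :
    rescale p (a • F + b • G) = a • rescale p F + b • rescale p G := by
  simp only [rescale, use_add_smul]
  refine Prod.ext rfl (Prod.ext rfl (Prod.ext rfl (Prod.ext rfl (Prod.ext ?_ ?_)))) <;> funext i <;>
    simp only [Prod.snd_add, Prod.fst_add, Prod.smul_snd, Prod.smul_fst, Pi.add_apply,
      Pi.smul_apply, smul_eq_mul]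
  · ring
  · split_ifs
    · rw [← add_mul, hab, one_mul]
    · ring

/-- Division by zero does no harm on unused intervals: generation is zero there, and costs are
copied. Costs have to be copied because they may be positive without flow. -/
theorem Feasible.rescale_edge (hg : g.Valid) (h : g.Feasible p) : rescale p (edge p) = p := by
  refine Prod.ext rfl (Prod.ext rfl (Prod.ext rfl (Prod.ext rfl (Prod.ext ?_ ?_)))) <;>
    funext ⟨⟨t, k, s⟩, hi⟩
  all_goals
    obtain ⟨hm, hts, hsk⟩ := mem_QIdx.1 hi
    have hd := h.dispatch hg hm
    have hu : use (ofEdge (edge p)) t k = use p t k := rfl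
  · change g.q p t k s / use p t k * use (ofEdge (edge p)) t k = _
    have hq : p.2.2.2.2.1 ⟨(t, k, s), hi⟩ = g.q p t k s := (val_of_mem _ hi).symm
    rw [hu, hq]
    by_cases h0 : use p t k = 0
    · rw [h0] at hd ⊢
      rw [hd.q_eq_zero hts hsk]
      simp
    · exact div_mul_cancel₀ _ h0
  · change (if use p t k = 0 then g.phi p t k s else
      g.phi p t k s / use p t k * use (ofEdge (edge p)) t k) = _
    have hq : p.2.2.2.2.2 ⟨(t, k, s), hi⟩ = g.phi p t k s := (val_of_mem _ hi).symm
    rw [hu, hq]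
    split_ifs with h0
    · rfl
    · exact div_mul_cancel₀ _ h0

/-- Costs are only bounded below, so an inequality suffices for them; this admits `c = 0` with the
old costs kept. -/
theorem Dispatch.scale {p p' : g.Space} {t k : ℕ} {r c : ℝ} (h : g.Dispatch p t k r) (hc : 0 ≤ c)
    (htk : t ≤ k) (hq : ∀ s, t ≤ s → s ≤ k → g.q p' t k s = c * g.q p t k s)
    (hphi : ∀ s, t ≤ s → s ≤ k → c * g.phi p t k s ≤ g.phi p' t k s) :
    g.Dispatch p' t k (c * r) := by
  refine ⟨?_, ?_, ?_, ?_, ?_, ?_⟩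
  · intro s hs
    rw [hq s (Finset.mem_Icc.1 hs).1 (Finset.mem_Icc.1 hs).2]
    linarith [mul_le_mul_of_nonneg_left (h.cap_lower s hs) hc]
  · intro s hs
    rw [hq s (Finset.mem_Icc.1 hs).1 (Finset.mem_Icc.1 hs).2]
    linarith [mul_le_mul_of_nonneg_left (h.cap_upper s hs) hc]
  · intro hk
    rw [hq k htk le_rfl]
    linarith [mul_le_mul_of_nonneg_left (h.shut hk) hc]
  · intro s hs
    obtain ⟨h1, h2⟩ := Finset.mem_Icc.1 hs
    rw [hq s (by omega) h2, hq (s - 1) (by omega) (by omega)]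
    linarith [mul_le_mul_of_nonneg_left (h.ramp_down s hs) hc]
  · intro s hs
    obtain ⟨h1, h2⟩ := Finset.mem_Icc.1 hs
    rw [hq s (by omega) h2, hq (s - 1) (by omega) (by omega)]
    linarith [mul_le_mul_of_nonneg_left (h.ramp_up s hs) hc]
  · intro s hs j
    obtain ⟨h1, h2⟩ := Finset.mem_Icc.1 hs
    rw [hq s h1 h2]
    linarith [mul_le_mul_of_nonneg_left (h.cost s hs j) hc, hphi s h1 h2]

theorem Valid.TK_bounds (hg : g.Valid) {t k : ℕ} (h : (t, k) ∈ g.TK) : 1 ≤ t ∧ t ≤ k ∧ k ≤ g.T := by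
  rcases mem_TK.1 h with h | h
  · obtain ⟨rfl, h1, h2⟩ := mem_TK1.1 h
    exact ⟨le_rfl, h1, (mem_Kbar.1 h2).2.2⟩
  · have := hg.on_bounds h
    omega

theorem IsFlow.use_nonneg (h : g.IsFlow p) (t k : ℕ) : 0 ≤ use p t k := by
  unfold use
  split_ifs
  · by_cases hm : k ∈ g.Kbar
    exacts [h.w_nonneg _ hm, (w_of_notMem p hm).ge]
  · by_cases hm : (t, k) ∈ g.TK2
    exacts [h.y_nonneg _ hm, (y_of_notMem p hm).ge]

/-- Rescaling to a flow in the support preserves feasibility. -/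
theorem Feasible.rescale (hg : g.Valid) (h : g.Feasible p) {F : g.Edge → ℝ}
    (hF : g.IsFlow (ofEdge F)) (hsupp : ∀ e, F e ≠ 0 → edge p e ≠ 0) :
    g.Feasible (rescale p F) := by
  have huse : ∀ {t k}, (t, k) ∈ g.TK → use p t k = 0 → use (ofEdge F) t k = 0 := by
    intro t k hi h0
    by_contra hne
    rcases mem_TK.1 hi with hi | hi
    · obtain ⟨rfl, -, hm⟩ := mem_TK1.1 hi
      rw [use_first] at h0 hne
      rw [← edge_w _ hm] at h0 hne
      rw [edge_ofEdge] at hne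
      exact hsupp _ hne h0
    · rw [hg.use_later _ hi] at h0 hne
      rw [← edge_y _ hi] at h0 hne
      rw [edge_ofEdge] at hne
      exact hsupp _ hne h0
  have hdis : ∀ {t k}, (t, k) ∈ g.TK →
      g.Dispatch (Generator.rescale p F) t k (use (ofEdge F) t k) := by
    intro t k hi
    have hd := h.dispatch hg hi
    have hb := hg.TK_bounds hi
    by_cases h0 : use p t k = 0
    · have h1 := huse hi h0
      rw [h0] at hd
      have hs := hd.scale (p' := Generator.rescale p F) le_rfl hb.2.1
        (fun s h2 h3 => by rw [q_rescale p F hi h2 h3, h1, mul_zero, zero_mul])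
        (fun s h2 h3 => by
          rw [phi_rescale p F hi h2 h3, if_pos h0, zero_mul]
          exact hd.phi_nonneg hg h2 h3)
      rwa [mul_zero, ← h1] at hs
    · have hs := hd.scale (p' := Generator.rescale p F) (c := use (ofEdge F) t k / use p t k)
        (div_nonneg (hF.use_nonneg t k) (h.isFlow.use_nonneg t k)) hb.2.1
        (fun s h2 h3 => by rw [q_rescale p F hi h2 h3]; ring)
        (fun s h2 h3 => by
          rw [phi_rescale p F hi h2 h3, if_neg h0]
          exact le_of_eq (by ring))
      rwa [div_mul_cancel₀ _ h0] at hs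
  refine ⟨hF.first, hF.balance_down, hF.balance_up, ?_, ?_, ?_, hF.w_nonneg, hF.y_nonneg,
    hF.z_nonneg, hF.theta_nonneg⟩
  · rintro ⟨t, k⟩ hi
    have := hdis (mem_TK.2 (.inl hi))
    obtain ⟨rfl, -⟩ := mem_TK1.1 hi
    exact this
  · rintro ⟨t, k⟩ hi
    have := hdis (mem_TK.2 (.inr hi))
    rwa [hg.use_later _ hi] at this
  · rintro ⟨t, k⟩ hi
    have hm := mem_TK.2 (.inr hi)
    have hst := h.start _ hi
    have hyF : g.y (Generator.rescale p F) t k = use (ofEdge F) t k := by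
      rw [hg.use_later _ hi]; rfl
    dsimp only at hst ⊢
    rw [q_rescale p F hm le_rfl (hg.TK_bounds hm).2.1, hyF]
    rw [← hg.use_later _ hi] at hst
    by_cases h0 : use p t k = 0
    · rw [huse hm h0, mul_zero, mul_zero]
    · have hpos := lt_of_le_of_ne (h.isFlow.use_nonneg t k) (Ne.symm h0)
      exact mul_le_mul_of_nonneg_right ((div_le_iff₀ hpos).2 hst) (hF.use_nonneg t k)

/-- The flows whose rescaled point lies in the hull form a convex set, as the preimage of one under
an affine map. It contains the binary flows in the support of `p`, hence the flow of `p`. -/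
theorem Valid.D4_eq (hg : g.Valid) : g.D4 = convexHull ℝ g.UC := by
  refine Set.Subset.antisymm ?_ (convexHull_min (fun p hp => ?_) (convex_D4 g))
  · intro p hp
    have hconv : Convex ℝ {F : g.Edge → ℝ | rescale p F ∈ convexHull ℝ g.UC} := by
      intro F hF G hG a b ha hb hab
      rw [Set.mem_ofPred_eq, rescale_comb p F G hab]
      exact convex_convexHull ℝ _ hF hG ha hb hab
    have := convexHull_min ?_ hconv (Feasible.isFlow hp |>.edge_mem_convexHull hg)
    · rwa [Set.mem_ofPred_eq, Feasible.rescale_edge hg hp] at this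
    · rintro F ⟨hF, hb, hs⟩
      refine subset_convexHull ℝ _ ?_
      rw [hg.uc_eq]
      refine ⟨Feasible.rescale hg hp hF hs, fun k hk => ?_, fun i hi => ?_, fun i hi => ?_⟩
      · rw [← edge_w _ hk]; exact hb _
      · rw [← edge_y _ hi]; exact hb _
      · rw [← edge_z _ hi]; exact hb _
  · rw [hg.uc_eq] at hp
    exact hp.1

/-! ### Optimal solutions -/

/-- The point `p` with its generation costs replaced by `Φ`. -/
def setPhi (p : g.Space) (Φ : g.QIdx → ℝ) : g.Space :=
  (p.1, p.2.1, p.2.2.1, p.2.2.2.1, p.2.2.2.2.1, Φ)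

/-- Costs occur only in the cost constraints, so they may be replaced by anything above the pieces.
-/
theorem Feasible.setPhi (hg : g.Valid) (h : g.Feasible p) {Φ : g.QIdx → ℝ}
    (hΦ : ∀ t k s (hi : (t, k, s) ∈ g.QIdx) (j : Fin g.N),
      g.a j * g.q p t k s + g.b j * use p t k ≤ Φ ⟨(t, k, s), hi⟩) :
    g.Feasible (setPhi p Φ) := by
  have hdis : ∀ {t k}, (t, k) ∈ g.TK → g.Dispatch (Generator.setPhi p Φ) t k (use p t k) := by
    intro t k hi
    have hd := h.dispatch hg hi
    refine ⟨hd.cap_lower, hd.cap_upper, hd.shut, hd.ramp_down, hd.ramp_up, fun s hs j => ?_⟩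
    have hm : (t, k, s) ∈ g.QIdx :=
      mem_QIdx.2 ⟨hi, (Finset.mem_Icc.1 hs).1, (Finset.mem_Icc.1 hs).2⟩
    have hphi : g.phi (Generator.setPhi p Φ) t k s = Φ ⟨(t, k, s), hm⟩ := val_of_mem _ hm
    have hq : g.q (Generator.setPhi p Φ) t k s = g.q p t k s := rfl
    rw [hphi, hq]
    linarith [hΦ t k s hm j]
  refine ⟨h.first, h.balance_down, h.balance_up, ?_, ?_, h.start, h.w_nonneg, h.y_nonneg,
    h.z_nonneg, h.theta_nonneg⟩
  · rintro ⟨t, k⟩ hi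
    have := hdis (mem_TK.2 (.inl hi))
    obtain ⟨rfl, -⟩ := mem_TK1.1 hi
    exact this
  · rintro ⟨t, k⟩ hi
    have := hdis (mem_TK.2 (.inr hi))
    rwa [hg.use_later _ hi] at this

theorem Feasible.use_le_one (hg : g.Valid) (h : g.Feasible p) (t k : ℕ) : use p t k ≤ 1 := by
  unfold use
  split_ifs
  · by_cases hm : k ∈ g.Kbar
    · rw [← edge_w p hm]; exact h.isFlow.edge_le_one hg _
    · rw [w_of_notMem p hm]; exact zero_le_one
  · by_cases hm : (t, k) ∈ g.TK2
    · rw [← edge_y p hm]; exact h.isFlow.edge_le_one hg _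
    · rw [y_of_notMem p hm]; exact zero_le_one

/-- The generation amounts are bounded on the polyhedron. -/
theorem Valid.exists_q_bound (hg : g.Valid) :
    ∃ B : ℝ, 0 ≤ B ∧ ∀ p ∈ g.D4, ∀ t k s, (t, k, s) ∈ g.QIdx → |g.q p t k s| ≤ B := by
  have hnn : ∀ s ∈ Finset.Icc 1 g.T, 0 ≤ |g.Pmin s| + |g.Pmax s| := fun s _ => by positivity
  refine ⟨∑ s ∈ Finset.Icc 1 g.T, (|g.Pmin s| + |g.Pmax s|), Finset.sum_nonneg hnn, ?_⟩
  intro p hp t k s hi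
  obtain ⟨hm, hts, hsk⟩ := mem_QIdx.1 hi
  have hb := hg.TK_bounds hm
  have hd := Feasible.dispatch hg hp hm
  have hl := hd.cap_lower s (Finset.mem_Icc.2 ⟨hts, hsk⟩)
  have hu := hd.cap_upper s (Finset.mem_Icc.2 ⟨hts, hsk⟩)
  have h0 := (Feasible.isFlow hp).use_nonneg t k
  have h1 := Feasible.use_le_one hg hp t k
  have hsum := Finset.single_le_sum hnn (Finset.mem_Icc.2 ⟨by omega, by omega⟩ : s ∈ _)
  have habs : ∀ c : ℝ, |c * use p t k| ≤ |c| := fun c => by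
    rw [abs_mul, abs_of_nonneg h0]
    exact mul_le_of_le_one_right (abs_nonneg c) h1
  have hl' := (abs_le.1 (habs (g.Pmin s))).1
  have hu' := (abs_le.1 (habs (g.Pmax s))).2
  refine le_trans (abs_le.2 ⟨?_, ?_⟩) hsum <;>
    linarith [abs_nonneg (g.Pmin s), abs_nonneg (g.Pmax s)]

/-- The lower bounds on the generation costs are bounded on the polyhedron. -/
theorem Valid.exists_cost_bound (hg : g.Valid) :
    ∃ M : ℝ, 0 ≤ M ∧ ∀ p ∈ g.D4, ∀ t k s, (t, k, s) ∈ g.QIdx → ∀ j,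
      |g.a j * g.q p t k s + g.b j * use p t k| ≤ M := by
  obtain ⟨B, hB, hq⟩ := hg.exists_q_bound
  have hnn : ∀ j ∈ Finset.univ, 0 ≤ |g.a j| * B + |g.b j| := fun j _ => by positivity
  refine ⟨∑ j, (|g.a j| * B + |g.b j|), Finset.sum_nonneg hnn, fun p hp t k s hi j => ?_⟩
  refine le_trans ?_ (Finset.single_le_sum hnn (Finset.mem_univ j))
  refine (abs_add_le _ _).trans (add_le_add ?_ ?_)
  · rw [abs_mul]
    exact mul_le_mul_of_nonneg_left (hq p hp t k s hi) (abs_nonneg _)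
  · rw [abs_mul, abs_of_nonneg ((Feasible.isFlow hp).use_nonneg t k)]
    exact mul_le_of_le_one_right (abs_nonneg _) (Feasible.use_le_one hg hp t k)

attribute [fun_prop] continuous_w continuous_y continuous_z continuous_theta continuous_q
  continuous_phi

/-- Each constraint is an equation or a weak inequality between continuous functions, so it passes
to limits. -/
theorem isClosed_D4 (g : Generator) : IsClosed g.D4 := by
  refine isClosed_of_closure_subset fun p hp => ?_
  have le : ∀ {l r : g.Space → ℝ}, (∀ p ∈ g.D4, l p ≤ r p) → Continuous l → Continuous r →
      l p ≤ r p := fun h hl hr => closure_minimal h (isClosed_le hl hr) hp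
  have eq : ∀ {l r : g.Space → ℝ}, (∀ p ∈ g.D4, l p = r p) → Continuous l → Continuous r →
      l p = r p := fun h hl hr => closure_minimal h (isClosed_eq hl hr) hp
  have dis : ∀ {t k : ℕ} {r : g.Space → ℝ}, (∀ p ∈ g.D4, g.Dispatch p t k (r p)) →
      Continuous r → g.Dispatch p t k (r p) := fun h hr =>
    ⟨fun s hs => le (fun p hp => (h p hp).cap_lower s hs) (by fun_prop) (by fun_prop),
      fun s hs => le (fun p hp => (h p hp).cap_upper s hs) (by fun_prop) (by fun_prop),
      fun hk => le (fun p hp => (h p hp).shut hk) (by fun_prop) (by fun_prop),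
      fun s hs => le (fun p hp => (h p hp).ramp_down s hs) (by fun_prop) (by fun_prop),
      fun s hs => le (fun p hp => (h p hp).ramp_up s hs) (by fun_prop) (by fun_prop),
      fun s hs j => le (fun p hp => (h p hp).cost s hs j) (by fun_prop) (by fun_prop)⟩
  exact ⟨eq (fun p hp => Feasible.first hp) (by fun_prop) (by fun_prop),
    fun s hs => eq (fun p hp => Feasible.balance_down hp s hs) (by fun_prop) (by fun_prop),
    fun s hs => eq (fun p hp => Feasible.balance_up hp s hs) (by fun_prop) (by fun_prop),
    fun i hi => dis (fun p hp => Feasible.dispatch_first hp i hi) (by fun_prop),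
    fun i hi => dis (fun p hp => Feasible.dispatch_later hp i hi) (by fun_prop),
    fun i hi => le (fun p hp => Feasible.start hp i hi) (by fun_prop) (by fun_prop),
    fun k hk => le (fun p hp => Feasible.w_nonneg hp k hk) (by fun_prop) (by fun_prop),
    fun i hi => le (fun p hp => Feasible.y_nonneg hp i hi) (by fun_prop) (by fun_prop),
    fun i hi => le (fun p hp => Feasible.z_nonneg hp i hi) (by fun_prop) (by fun_prop),
    fun k hk => le (fun p hp => Feasible.theta_nonneg hp k hk) (by fun_prop) (by fun_prop)⟩

/-- The part of the polyhedron with generation costs at most `M` is compact. -/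
theorem Valid.isCompact_D4_inter (hg : g.Valid) (M : ℝ) :
    IsCompact (g.D4 ∩ {p | ∀ i, p.2.2.2.2.2 i ≤ M}) := by
  obtain ⟨B, hB, hq⟩ := hg.exists_q_bound
  obtain ⟨M', hM', hM⟩ := hg.exists_cost_bound
  have hclosed : IsClosed {p : g.Space | ∀ i, p.2.2.2.2.2 i ≤ M} := by
    simp only [Set.ofPred_forall]
    exact isClosed_iInter fun i => isClosed_le (by fun_prop) (by fun_prop)
  -- A box around the set: flows lie in `[0, 1]`, generation within `B`, and any one cost piece
  -- bounds `φ` below by `-M'`.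
  let lo : g.Space := (0, 0, 0, 0, fun _ => -B, fun _ => -M')
  let hi : g.Space := (1, 1, 1, 1, fun _ => B, fun _ => M)
  refine (isCompact_Icc (a := lo) (b := hi)).of_isClosed_subset
    ((isClosed_D4 g).inter hclosed) ?_
  rintro p ⟨hp, hpM⟩
  have h := Feasible.isFlow hp
  have h0 := h.edge_nonneg
  have h1 := h.edge_le_one hg
  have hq' : ∀ i, |p.2.2.2.2.1 i| ≤ B := by
    rintro ⟨⟨t, k, s⟩, hi⟩
    have := hq p hp t k s hi
    rwa [show g.q p t k s = p.2.2.2.2.1 ⟨(t, k, s), hi⟩ from val_of_mem _ hi] at this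
  have hphi : ∀ i, -M' ≤ p.2.2.2.2.2 i := by
    rintro ⟨⟨t, k, s⟩, hi⟩
    obtain ⟨hm, hts, hsk⟩ := mem_QIdx.1 hi
    have h2 := (Feasible.dispatch hg hp hm).cost s (Finset.mem_Icc.2 ⟨hts, hsk⟩) ⟨0, hg.N_pos⟩
    have h3 := (abs_le.1 (hM p hp t k s hi ⟨0, hg.N_pos⟩)).1
    rw [show g.phi p t k s = p.2.2.2.2.2 ⟨(t, k, s), hi⟩ from val_of_mem _ hi] at h2
    linarith
  exact ⟨⟨fun i => h0 (.inl i), fun i => h0 (.inr (.inl i)), fun i => h0 (.inr (.inr (.inl i))),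
      fun i => h0 (.inr (.inr (.inr i))), fun i => (abs_le.1 (hq' i)).1, hphi⟩,
    ⟨fun i => h1 (.inl i), fun i => h1 (.inr (.inl i)), fun i => h1 (.inr (.inr (.inl i))),
      fun i => h1 (.inr (.inr (.inr i))), fun i => (abs_le.1 (hq' i)).2, hpM⟩⟩

/-- The point `p` with its generation costs capped at `M`. -/
noncomputable def capPhi (M : ℝ) (p : g.Space) : g.Space :=
  setPhi p fun i => min (p.2.2.2.2.2 i) M

/-- A linear objective that does not increase when generation costs are capped attains its minimum
at a binary point. -/
theorem Valid.exists_binary_minimizer (hg : g.Valid) (hne : g.D4.Nonempty) (c : g.Space →ₗ[ℝ] ℝ)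
    (hc : ∀ p ∈ g.D4, ∀ M, c (capPhi M p) ≤ c p) :
    ∃ p ∈ g.D4, g.IsBinary p ∧ ∀ p' ∈ g.D4, c p ≤ c p' := by
  -- Above `M` no cost constraint can bind, so capping at `M` keeps feasibility.
  obtain ⟨M, -, hM⟩ := hg.exists_cost_bound
  have hcap : ∀ p ∈ g.D4, capPhi M p ∈ g.D4 ∩ {p | ∀ i, p.2.2.2.2.2 i ≤ M} := fun p hp => by
    refine ⟨Feasible.setPhi hg hp fun t k s hi j => le_min ?_ ?_, fun i => min_le_right _ _⟩
    · obtain ⟨hm, hts, hsk⟩ := mem_QIdx.1 hi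
      have h2 := (Feasible.dispatch hg hp hm).cost s (Finset.mem_Icc.2 ⟨hts, hsk⟩) j
      rw [show g.phi p t k s = p.2.2.2.2.2 ⟨(t, k, s), hi⟩ from val_of_mem _ hi] at h2
      linarith
    · exact (abs_le.1 (hM p hp t k s hi j)).2
  obtain ⟨p₀, hp₀⟩ := hne
  obtain ⟨q, hq, hmin⟩ := (hg.isCompact_D4_inter M).exists_isMinOn ⟨_, hcap p₀ hp₀⟩
    (LinearMap.continuous_of_finiteDimensional c).continuousOn
  have hopt : ∀ p' ∈ g.D4, c q ≤ c p' := fun p' hp' => (hmin (hcap p' hp')).trans (hc p' hp' M)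
  have hq' : q ∈ convexHull ℝ g.UC := hg.D4_eq ▸ hq.1
  -- Otherwise an open half-space would contain `UC`, hence its hull, hence `q` itself.
  obtain ⟨p, hp, hle⟩ : ∃ p ∈ g.UC, c p ≤ c q := by
    by_contra! hcon
    have := convexHull_min (t := {p | c q < c p}) hcon
      (convex_halfSpace_gt (𝕜 := ℝ) c.isLinear (c q)) hq'
    exact lt_irrefl (c q) this
  rw [hg.uc_eq] at hp
  exact ⟨p, hp.1, hp.2, fun p' hp' => hle.trans (hopt p' hp')⟩

/-- An objective that is bounded below on the polyhedron does not increase when generation costs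
are capped. -/
theorem Valid.map_capPhi_le (hg : g.Valid) {c : g.Space →ₗ[ℝ] ℝ} (hc : BddBelow (c '' g.D4))
    (hp : p ∈ g.D4) (M : ℝ) : c (capPhi M p) ≤ c p := by
  obtain ⟨m, hm⟩ := hc
  -- Undoing the cap only raises costs, so `p - capPhi M p` is a recession direction.
  have hray : ∀ r : ℝ, 0 ≤ r → p + r • (p - capPhi M p) ∈ g.D4 := by
    intro r hr
    have he : p + r • (p - capPhi M p) = setPhi p fun i =>
        p.2.2.2.2.2 i + r * (p.2.2.2.2.2 i - min (p.2.2.2.2.2 i) M) := by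
      simp only [capPhi, setPhi]
      refine Prod.ext ?_ (Prod.ext ?_ (Prod.ext ?_ (Prod.ext ?_ (Prod.ext ?_ ?_)))) <;>
        funext i <;> simp
    rw [he]
    refine Feasible.setPhi hg hp fun t k s hi j => ?_
    obtain ⟨hk, hts, hsk⟩ := mem_QIdx.1 hi
    have h2 := (Feasible.dispatch hg hp hk).cost s (Finset.mem_Icc.2 ⟨hts, hsk⟩) j
    rw [show g.phi p t k s = p.2.2.2.2.2 ⟨(t, k, s), hi⟩ from val_of_mem _ hi] at h2
    have h3 := mul_nonneg hr (sub_nonneg.2 (min_le_left (p.2.2.2.2.2 ⟨(t, k, s), hi⟩) M))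
    linarith
  by_contra! hlt
  have hmp : m ≤ c p := hm ⟨p, hp, rfl⟩
  have hd : 0 < c (capPhi M p) - c p := by linarith
  -- The step length is chosen so that the objective reaches `m - 1`, below its lower bound `m`.
  have := hm ⟨_, hray ((c p - m + 1) / (c (capPhi M p) - c p)) (by
    apply div_nonneg <;> linarith), rfl⟩
  rw [map_add, map_smul, map_sub, smul_eq_mul, div_mul_eq_mul_div, ← neg_sub (c (capPhi M p)),
    mul_neg, neg_div, mul_div_cancel_right₀ _ hd.ne'] at this
  linarith

/-- The objective as a linear map. -/
noncomputable def costLinear (g : Generator) : g.Space →ₗ[ℝ] ℝ where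
  toFun := g.cost
  map_add' p p' := by
    simp only [cost, w_add, y_add, z_add, phi_add, mul_add, Finset.sum_add_distrib]
    ring
  map_smul' r p := by
    simp only [cost, w_smul, y_smul, z_smul, phi_smul, RingHom.id_apply, smul_eq_mul,
      mul_left_comm _ r, ← Finset.mul_sum, ← mul_add]

theorem cost_capPhi_le (M : ℝ) (p : g.Space) : g.cost (capPhi M p) ≤ g.cost p := by
  refine add_le_add_right (Finset.sum_le_sum fun i _ => Finset.sum_le_sum fun s _ => ?_) _
  by_cases hm : (i.1, i.2, s) ∈ g.QIdx
  · have h1 : g.phi (capPhi M p) i.1 i.2 s = min (p.2.2.2.2.2 ⟨(i.1, i.2, s), hm⟩) M :=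
      val_of_mem _ hm
    have h2 : g.phi p i.1 i.2 s = p.2.2.2.2.2 ⟨(i.1, i.2, s), hm⟩ := val_of_mem _ hm
    rw [h1, h2]
    exact min_le_left _ _
  · have h1 : g.phi (capPhi M p) i.1 i.2 s = 0 := val_of_notMem _ hm
    have h2 : g.phi p i.1 i.2 s = 0 := val_of_notMem _ hm
    rw [h1, h2]

end Generator

theorem theorem2 (g : Generator) (hg : g.Valid) :
    -- the polyhedron is the convex hull of the feasible set of the unit commitment problem
    g.D4 = convexHull ℝ g.UC ∧
    -- whose points are exactly the binary points of the polyhedron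
    g.UC = {p | p ∈ g.D4 ∧ g.IsBinary p} ∧
    -- every linear objective that is bounded below on it has a binary optimal solution
    (g.D4.Nonempty → ∀ c : g.Space →ₗ[ℝ] ℝ, BddBelow (c '' g.D4) →
      ∃ p ∈ g.D4, g.IsBinary p ∧ ∀ p' ∈ g.D4, c p ≤ c p') ∧
    -- the linear program, when feasible, has a binary optimal solution
    (g.D4.Nonempty → ∃ p ∈ g.D4, g.IsBinary p ∧ ∀ p' ∈ g.D4, g.cost p ≤ g.cost p') :=
  ⟨hg.D4_eq, hg.uc_eq,
    fun hne c hc => hg.exists_binary_minimizer hne c fun _ hp M => hg.map_capPhi_le hc hp M,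
    fun hne => hg.exists_binary_minimizer hne g.costLinear fun p _ M => Generator.cost_capPhi_le M p⟩
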